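/- Let $0\le k\le n$ be integers with $n\ge 1$ and $2k\le n$. Let $M$ be the disjointness matrix: its rows and columns are indexed by the $k$-element subsets of $\{1,\dots,n\}$, and $M_{S,T}=1$ if $S\cap T=\emptyset$, $M_{S,T}=0$ otherwise. Let $D$ be the number of ordered pairs of disjoint $k$-subsets, so $\|M\|_F^2=D$, and let $|\chi\rangle=D^{-1/2}\sum_{S\cap T=\emptyset}|S\rangle|T\rangle$ be the uniform superposition over these pairs. For an orthonormal basis $V=(v_0,v_1,\dots)$ of eigenvectors of $M$, listed so that the absolute values of the eigenvalues decrease, write $\lambda_0,\lambda_1,\dots$ for the corresponding eigenvalues of $M/\sqrt D$, regard $V$ also as the unitary $|j\rangle\mapsto v_j$, let $P_t$ be the orthogonal projection onto $\mathrm{span}\{v_i\otimes v_j: i,j<t\}$, let $|\psi_t\rangle=(V\otimes V)^{-1}P_t|\chi\rangle$ be the projection of $|\chi\rangle$ onto the span of the top $t$ eigenvectors, in the coordinates of $V$, and let $|\hat\psi_t\rangle=|\psi_t\rangle/\|\psi_t\|$ be the corresponding pure state. (a) Let $k=\lfloor\sqrt n\rfloor$. There is such a basis $V$ with the following property: for every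 $\varepsilon\in(0,1)$, with $t=\lfloor n^{\log_2(1/\varepsilon)}\rfloor$, $$\langle\chi|(V\otimes V)|\hat\psi_t\rangle>1-\varepsilon,\qquad \big\|\,|\chi\rangle-(V\otimes V)|\psi_t\rangle\big\|^2=\sum_{j\ge t}\lambda_j^2<2\varepsilon .$$ (b) For every $c>0$ there is a constant $C>0$, depending only on $c$, such that for all $n\ge1$ and $k$ with $k\le c\sqrt n$ and $2k\le n$ the following hold. (i) There is such a basis $V$ with the following property: for every $\varepsilon\in(0,1)$, with $t=\lfloor n^{C\log_2(1/\varepsilon)}\rfloor$, $$\langle\chi|(V\otimes V)|\psi_t\rangle>1-\varepsilon,\qquad \langle\chi|(V\otimes V)|\hat\psi_t\rangle>1-\varepsilon,\qquad \big\|\,|\chi\rangle-(V\otimes V)|\psi_t\rangle\big\|^2=\sum_{j\ge t}\lambda_j^2<2\varepsilon .$$ (ii) For every $\varepsilon\in(0,1)$, $|\chi\rangle$ can be q-sampled with error $\varepsilon$ and no communication from at most $C\log_2 n\,\log_2(1/\varepsilon)$ shared qubits: there are $a,b\ge 0$ with $a+b\le C\log_2 n\log_2(1/\varepsilon)$, a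 pure state $|\varphi\rangle$ of $a+b$ qubits, $a$ held by Alice and $b$ by Bob, and unitaries $U_A,U_B$, each acting on one party's qubits together with ancilla qubits in state $|0\rangle$, such that $\mathrm{Re}\,\langle\chi|(U_A\otimes U_B)|\varphi\,0\cdots0\rangle>1-\varepsilon$. Here a subset $S$ is encoded in the computational basis by its characteristic string, padded with zeros. -/

import Mathlib

open scoped TensorProduct

noncomputable section

namespace DisjSampling

/-- The subsets of size `k` of an `n`-element set. -/
abbrev KSet (n k : ℕ) : Type := {S : Finset (Fin n) // S.card = k}

/-- One party's register: the Hilbert space with computational basis the `k`-subsets. -/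
abbrev SetReg (n k : ℕ) : Type := EuclideanSpace ℂ (KSet n k)

/-- The register of `m` qubits. -/
abbrev Qubits (m : ℕ) : Type := EuclideanSpace ℂ (Fin m → Bool)

/-- The computational basis state `|i⟩`. -/
def ket {ι : Type*} [Fintype ι] [DecidableEq ι] (i : ι) : EuclideanSpace ℂ ι :=
  EuclideanSpace.single i 1

/-- The disjointness matrix `M` on `k`-subsets. -/
def disjMatrix (n k : ℕ) : Matrix (KSet n k) (KSet n k) ℂ :=
  Matrix.of fun S T => if Disjoint S.1 T.1 then 1 else 0

/-- The number of ordered pairs of disjoint `k`-subsets. -/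
def numDisjoint (n k : ℕ) : ℕ :=
  (Finset.univ.filter fun p : KSet n k × KSet n k => Disjoint p.1.1 p.2.1).card

/-- The state `|χ⟩`: the uniform superposition over ordered pairs of disjoint `k`-subsets. -/
def chi (n k : ℕ) : SetReg n k ⊗[ℂ] SetReg n k :=
  ((Real.sqrt (numDisjoint n k) : ℝ) : ℂ)⁻¹ •
    ∑ S : KSet n k, ∑ T : KSet n k, if Disjoint S.1 T.1 then ket S ⊗ₜ[ℂ] ket T else 0

/-- `V` is an orthonormal basis of eigenvectors of the disjointness matrix, with eigenvalues
`lam`, listed in order of decreasing absolute value of the eigenvalue. -/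
def IsOrderedEigenbasis {n k : ℕ}
    (V : OrthonormalBasis (Fin (n.choose k)) ℂ (SetReg n k)) (lam : Fin (n.choose k) → ℝ) : Prop :=
  (∀ i j, i ≤ j → |lam j| ≤ |lam i|) ∧
    ∀ j, Matrix.toEuclideanLin (disjMatrix n k) (V j) = (lam j : ℂ) • V j

/-- The unitary `V ⊗ V`, where `V` takes the coordinate vector `|j⟩` to the `j`-th basis
vector. -/
def rotate {n k : ℕ} (V : OrthonormalBasis (Fin (n.choose k)) ℂ (SetReg n k)) :
    (EuclideanSpace ℂ (Fin (n.choose k)) ⊗[ℂ] EuclideanSpace ℂ (Fin (n.choose k))) ≃ₗᵢ[ℂ]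
      (SetReg n k ⊗[ℂ] SetReg n k) :=
  TensorProduct.congrIsometry V.repr.symm V.repr.symm

/-- The subspace `V_t ⊗ V_t`, where `V_t` is the span of the first `t` basis vectors. -/
def topSpan {n k : ℕ} (V : OrthonormalBasis (Fin (n.choose k)) ℂ (SetReg n k)) (t : ℕ) :
    Submodule ℂ (SetReg n k ⊗[ℂ] SetReg n k) :=
  Submodule.span ℂ {x | ∃ i j : Fin (n.choose k),
    (i : ℕ) < t ∧ (j : ℕ) < t ∧ x = V i ⊗ₜ[ℂ] V j}

/-- The orthogonal projection of `|χ⟩` onto `V_t ⊗ V_t`, written in the coordinates of the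
basis `V`. It is not normalized. -/
def psi {n k : ℕ} (V : OrthonormalBasis (Fin (n.choose k)) ℂ (SetReg n k)) (t : ℕ) :
    EuclideanSpace ℂ (Fin (n.choose k)) ⊗[ℂ] EuclideanSpace ℂ (Fin (n.choose k)) :=
  (rotate V).symm ((topSpan V t).starProjection (chi n k))

/-- The tail `∑_{j ≥ t} λ_j²` for the eigenvalues `λ_j = lam j / ‖M‖_F` of the normalized
disjointness matrix `M / ‖M‖_F` (the matrix of amplitudes of `|χ⟩`); `‖M‖_F² = numDisjoint`. -/
def tail {n k : ℕ} (lam : Fin (n.choose k) → ℝ) (t : ℕ) : ℝ :=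
  ∑ j : Fin (n.choose k), if t ≤ (j : ℕ) then lam j ^ 2 / (numDisjoint n k : ℝ) else 0

/-- The pure state (unit vector) in the direction of a nonzero vector `v`. -/
def pureState {E : Type*} [NormedAddCommGroup E] [InnerProductSpace ℂ E] (v : E) : E :=
  ((‖v‖ : ℝ) : ℂ)⁻¹ • v

/-- Pad a string of `a` bits with zeros to a string of `L` bits (used for `a ≤ L`). -/
def padString {a : ℕ} (L : ℕ) (x : Fin a → Bool) : Fin L → Bool :=
  fun i => if h : (i : ℕ) < a then x ⟨i, h⟩ else false

/-- Append ancilla qubits in the state `|0⟩`: `|x⟩ ↦ |x 0…0⟩`. -/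
def addAncilla (a L : ℕ) : Qubits a →ₗ[ℂ] Qubits L :=
  (EuclideanSpace.basisFun (Fin a → Bool) ℂ).toBasis.constr ℂ fun x => ket (padString L x)

/-- Encode a subset by its characteristic string, followed by zeros, in `L ≥ n` qubits. -/
def encode (n k L : ℕ) : SetReg n k →ₗ[ℂ] Qubits L :=
  (EuclideanSpace.basisFun (KSet n k) ℂ).toBasis.constr ℂ fun S =>
    ket (padString L fun i => decide (i ∈ S.1))

/-- There is a protocol that q-samples `|χ⟩` with error `ε`: the parties share a pure state of
`a + b` qubits, `a` of them held by Alice and `b` by Bob, each appends ancilla qubits in the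
state `|0⟩` and applies a local unitary, and the result has overlap more than `1 - ε` with
`|χ⟩`. Nothing is communicated. -/
def QSamples (n k : ℕ) (ε : ℝ) (a b : ℕ) : Prop :=
  ∃ LA LB : ℕ, a ≤ LA ∧ b ≤ LB ∧ n ≤ LA ∧ n ≤ LB ∧
    ∃ (φ : Qubits a ⊗[ℂ] Qubits b) (UA : Qubits LA ≃ₗᵢ[ℂ] Qubits LA)
      (UB : Qubits LB ≃ₗᵢ[ℂ] Qubits LB), ‖φ‖ = 1 ∧
      1 - ε < (inner ℂ (TensorProduct.map (encode n k LA) (encode n k LB) (chi n k))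
        (TensorProduct.congrIsometry UA UB
          (TensorProduct.map (addAncilla a LA) (addAncilla b LB) φ))).re

end DisjSampling

end

namespace DisjSampling

/-! The amplitude matrix of $|\chi\rangle$ is $M/\sqrt D$, so a real eigenbasis gives
$|\chi\rangle=\sum_j\lambda_j\,v_j\otimes v_j$ (`chi_eq_diagTensor`). Projecting onto the top $t$
vectors truncates this sum. With tail $\tau=\sum_{j\ge t}\lambda_j^2$, the squared error is $\tau$,
the overlap with $\psi_t$ is $1-\tau$, and the overlap with the normalized state is $\sqrt{1-\tau}$.
The latter exceeds $1-\varepsilon$ once $\tau<2\varepsilon-\varepsilon^2$, so everything reduces to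
bounding $\tau$.

The full spectral decomposition of $M$ is not needed. On the filtration by spans of indicators of
$\{S\supseteq Q\}$, $|Q|<i$, the matrix is triangular with diagonal entries
$(-1)^s\binom{n-k-s}{k-s}$ (`toEuclideanLin_sub_mem_lowSpan`), and the sets with $|Q|\le s$ span
dimension at most $\binom ns$. Hence $|\lambda_j|\sqrt D\le\binom{n-k-r-1}{k-r-1}$ for $j\ge\binom
nr$ (`abs_eigenvalue_le`), and for $t\ge n^r$ the tail is at most $\sum_{s>r}w_s$, where $w_s$ is
`levelWeight` (`tail_le_sum_levelWeight`). For $r=0$ the better bound $\tau\le1-w_0$ comes from the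
top eigenvalue alone (`tail_le_one_sub`).

When $k=O(\sqrt n)$ the ratio $w_{s+1}/w_s$ is $O(1/s)$, so these sums decay at least geometrically
in $r$. For $k=\lfloor\sqrt n\rfloor$ the explicit constants suffice, apart from $n=4$ and, for
$\varepsilon>1/2$, $n=9$; there concavity of the partial sums of $\lambda_j^2$ helps. For $k\le
c\sqrt n$, `exists_tail_lt` merges the small-$r$ and large-$r$ bounds. The protocol shares the
normalized truncation, stored in $m$ qubits per party when $t=2^m$, and each party rotates into the
eigenbasis. -/

/-! ### Eigenvalue bounds from a triangular filtration. -/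

/-- The indicator vector of the `k`-subsets containing `Q`. -/
noncomputable def inc (n k : ℕ) (Q : Finset (Fin n)) : SetReg n k :=
  WithLp.toLp 2 fun S => if Q ⊆ S.1 then 1 else 0

/-- The span of the indicator vectors of the sets `{S ⊇ Q}` with `|Q| < i`. -/
noncomputable def lowSpan (n k i : ℕ) : Submodule ℂ (SetReg n k) :=
  Submodule.span ℂ {x | ∃ Q : Finset (Fin n), Q.card < i ∧ x = inc n k Q}

lemma inc_mem_lowSpan {n k i : ℕ} {Q : Finset (Fin n)} (h : Q.card < i) :
    inc n k Q ∈ lowSpan n k i := Submodule.subset_span ⟨Q, h, rfl⟩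

lemma card_kset (n k : ℕ) : Fintype.card (KSet n k) = n.choose k := by
  rw [Fintype.card_finset_len, Fintype.card_fin]

/-- The number of `k`-subsets of `A` containing `Q`. -/
lemma card_between {n k : ℕ} {Q A : Finset (Fin n)} (hQA : Q ⊆ A) (hQ : Q.card ≤ k) :
    (Finset.univ.filter fun S : KSet n k => Q ⊆ S.1 ∧ S.1 ⊆ A).card =
      (A.card - Q.card).choose (k - Q.card) := by
  rw [← Finset.card_sdiff_of_subset hQA, ← Finset.card_powersetCard]
  refine Finset.card_bij' (fun S _ => S.1 \ Q)
    (fun B hB => ⟨B ∪ Q, ?_⟩) ?_ ?_ ?_ ?_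
  · rw [Finset.mem_powersetCard] at hB
    rw [Finset.card_union_of_disjoint, hB.2]
    · omega
    · exact Finset.disjoint_of_subset_left hB.1 Finset.sdiff_disjoint
  · intro S hS
    simp only [Finset.mem_filter, Finset.mem_univ, true_and] at hS
    rw [Finset.mem_powersetCard]
    refine ⟨Finset.sdiff_subset_sdiff hS.2 le_rfl, ?_⟩
    rw [Finset.card_sdiff_of_subset hS.1, S.2]
  · intro B hB
    rw [Finset.mem_powersetCard] at hB
    simp only [Finset.mem_filter, Finset.mem_univ, true_and]
    exact ⟨Finset.subset_union_right,
      Finset.union_subset (hB.1.trans Finset.sdiff_subset) hQA⟩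
  · intro S hS
    simp only [Finset.mem_filter, Finset.mem_univ, true_and] at hS
    exact Subtype.ext (Finset.sdiff_union_of_subset hS.1)
  · intro B hB
    rw [Finset.mem_powersetCard] at hB
    have hd : Disjoint B Q := Finset.disjoint_of_subset_left hB.1 Finset.sdiff_disjoint
    simp only [Finset.union_sdiff_right]
    exact Finset.sdiff_eq_self_of_disjoint hd

/-- The entry at $T$ counts the $k$-sets $S\supseteq Q$ disjoint from $T$: it vanishes unless $Q\cap
T=\emptyset$ and is otherwise independent of $T$. The indicator of $Q\cap T=\emptyset$ expands by
inclusion-exclusion over subsets of $Q$. -/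
lemma toEuclideanLin_inc {n k : ℕ} {Q : Finset (Fin n)} (hQ : Q.card ≤ k) :
    Matrix.toEuclideanLin (disjMatrix n k) (inc n k Q) =
      ((n - k - Q.card).choose (k - Q.card) : ℂ) •
        ∑ P ∈ Q.powerset, (-1 : ℂ) ^ P.card • inc n k P := by
  ext T
  have h1 : (∑ P ∈ Q.powerset, (-1 : ℂ) ^ P.card • inc n k P) T =
      if Disjoint Q T.1 then 1 else 0 := by
    have : ∀ P ∈ Q.powerset, ((-1 : ℂ) ^ P.card • inc n k P) T =
        if P ⊆ T.1 then (-1 : ℂ) ^ P.card else 0 := by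
      intro P _
      simp [inc]
    simp only [WithLp.ofLp_sum, Finset.sum_apply]
    rw [Finset.sum_congr rfl this, ← Finset.sum_filter]
    have h2 : Q.powerset.filter (fun P => P ⊆ T.1) = (Q ∩ T.1).powerset := by
      ext P; simp only [Finset.mem_filter, Finset.mem_powerset, Finset.subset_inter_iff]
    rw [h2]
    have h3 := congrArg (Int.cast : ℤ → ℂ) (Finset.sum_powerset_neg_one_pow_card (x := Q ∩ T.1))
    push_cast at h3
    rw [h3]
    simp [Finset.disjoint_iff_inter_eq_empty]
  have h4 : Matrix.toEuclideanLin (disjMatrix n k) (inc n k Q) T =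
      ((Finset.univ.filter fun S : KSet n k => Disjoint T.1 S.1 ∧ Q ⊆ S.1).card : ℂ) := by
    rw [Matrix.toLpLin_apply]
    simp only [Matrix.mulVec, dotProduct, disjMatrix, Matrix.of_apply, inc]
    rw [Finset.card_filter]
    push_cast
    refine Finset.sum_congr rfl fun S _ => ?_
    by_cases h5 : Disjoint T.1 S.1 <;> by_cases h6 : Q ⊆ S.1 <;> simp [h5, h6]
  rw [PiLp.smul_apply, h1, h4]
  by_cases h : Disjoint Q T.1
  · have h7 := card_between (k := k) (Q := Q) (A := T.1ᶜ)
      (Finset.subset_compl_iff_disjoint_right.2 h) hQ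
    rw [Finset.card_compl, T.2, Fintype.card_fin] at h7
    rw [← h7]
    simp only [h, if_true, smul_eq_mul, mul_one]
    congr 2
    ext S
    simp only [Finset.mem_filter, Finset.mem_univ, true_and, Finset.subset_compl_iff_disjoint_left]
    tauto
  · rw [if_neg h, smul_zero, Nat.cast_eq_zero, Finset.card_eq_zero, Finset.filter_eq_empty_iff]
    rintro S - ⟨h8, h9⟩
    exact h (Finset.disjoint_of_subset_left h9 h8.symm)

/-- In the inclusion-exclusion formula only the term $P=Q$ with $|Q|=s$ stays at level $s$. This is
the triangularity that replaces diagonalization. -/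
lemma toEuclideanLin_sub_mem_lowSpan {n k s : ℕ} (hs : s ≤ k) {f : SetReg n k}
    (hf : f ∈ lowSpan n k (s + 1)) :
    Matrix.toEuclideanLin (disjMatrix n k) f -
      ((-1 : ℂ) ^ s * ((n - k - s).choose (k - s) : ℂ)) • f ∈ lowSpan n k s := by
  induction hf using Submodule.span_induction with
  | zero => simp
  | add x y _ _ hx hy =>
    rw [map_add, smul_add, add_sub_add_comm]
    exact Submodule.add_mem _ hx hy
  | smul a x _ hx =>
    rw [map_smul, smul_comm, ← smul_sub]
    exact Submodule.smul_mem _ _ hx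
  | mem x hx =>
    obtain ⟨Q, hQ, rfl⟩ := hx
    rw [toEuclideanLin_inc (by omega)]
    rcases Nat.lt_or_ge Q.card s with h | h
    · refine Submodule.sub_mem _ (Submodule.smul_mem _ _ (Submodule.sum_mem _ fun P hP => ?_))
        (Submodule.smul_mem _ _ (inc_mem_lowSpan h))
      exact Submodule.smul_mem _ _ (inc_mem_lowSpan
        ((Finset.card_le_card (Finset.mem_powerset.1 hP)).trans_lt h))
    · have h' : Q.card = s := by omega
      rw [← Finset.sum_erase_add _ _ (Finset.mem_powerset_self Q), smul_add, smul_smul, h',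
        mul_comm ((_ : ℕ) : ℂ) ((-1) ^ s), add_sub_cancel_right]
      refine Submodule.smul_mem _ _ (Submodule.sum_mem _ fun P hP => ?_)
      rw [Finset.mem_erase, Finset.mem_powerset] at hP
      exact Submodule.smul_mem _ _ (inc_mem_lowSpan (h' ▸ Finset.card_lt_card
        (lt_of_le_of_ne hP.2 hP.1)))

lemma lowSpan_top (n k : ℕ) : lowSpan n k (k + 1) = ⊤ := by
  rw [eq_top_iff, ← (EuclideanSpace.basisFun (KSet n k) ℂ).toBasis.span_eq, Submodule.span_le]
  rintro _ ⟨S, rfl⟩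
  refine Submodule.subset_span ⟨S.1, by rw [S.2]; omega, ?_⟩
  ext T
  simp only [OrthonormalBasis.coe_toBasis, EuclideanSpace.basisFun_apply, inc,
    PiLp.single_apply]
  congr 1
  rw [eq_iff_iff]
  constructor
  · rintro rfl; rfl
  · intro h
    exact Subtype.ext (Finset.eq_of_subset_of_card_le h (by rw [S.2, T.2])).symm

/-- Descent through the filtration: modulo level $s$, $M$ acts on the next step as a scalar
different from $x$, so $(x-\text{scalar})\,v$, and hence $v$, drops one level. -/
lemma eigenvector_mem_lowSpan {n k m : ℕ} (hm : m ≤ k + 1) {v : SetReg n k} {x : ℝ}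
    (hv : Matrix.toEuclideanLin (disjMatrix n k) v = (x : ℂ) • v)
    (hx : ∀ s, m ≤ s → s ≤ k → ((n - k - s).choose (k - s) : ℝ) < |x|) :
    v ∈ lowSpan n k m := by
  suffices ∀ d, d ≤ k + 1 - m → v ∈ lowSpan n k (k + 1 - d) by
    have := this (k + 1 - m) le_rfl
    rwa [Nat.sub_sub_self hm] at this
  intro d
  induction d with
  | zero => intro _; simp [lowSpan_top]
  | succ d ih =>
    intro hd
    have h1 := ih (by omega)
    set s := k + 1 - (d + 1)
    rw [show k + 1 - d = s + 1 by omega] at h1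
    have h2 := toEuclideanLin_sub_mem_lowSpan (by omega : s ≤ k) h1
    rw [hv, ← sub_smul] at h2
    refine (Submodule.smul_mem_iff _ ?_).1 h2
    intro h3
    have h4 := hx s (by omega) (by omega)
    have h5 : x = (-1) ^ s * ((n - k - s).choose (k - s) : ℝ) := by
      rw [sub_eq_zero] at h3
      exact_mod_cast h3
    rw [h5, abs_mul, abs_pow, abs_neg, abs_one, one_pow, one_mul, Nat.abs_cast] at h4
    exact lt_irrefl _ h4

/-- Summing the indicators of all $s$-sets $R\supseteq Q$ counts each $S\supseteq Q$ the same
positive number of times. Thus $\binom ns$ generators suffice for the dimension bound. -/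
lemma inc_mem_span_card {n k s : ℕ} (hs : s ≤ k) (Q : Finset (Fin n)) (hQ : Q.card ≤ s) :
    inc n k Q ∈ Submodule.span ℂ (Set.range fun R : KSet n s => inc n k R.1) := by
  have key : ∑ R : KSet n s, (if Q ⊆ R.1 then inc n k R.1 else 0) =
      ((k - Q.card).choose (s - Q.card) : ℂ) • inc n k Q := by
    ext S
    have h1 : (∑ R : KSet n s, (if Q ⊆ R.1 then inc n k R.1 else 0)) S =
        ((Finset.univ.filter fun R : KSet n s => Q ⊆ R.1 ∧ R.1 ⊆ S.1).card : ℂ) := by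
      rw [Finset.card_filter]
      simp only [WithLp.ofLp_sum, Finset.sum_apply]
      push_cast
      refine Finset.sum_congr rfl fun R _ => ?_
      by_cases h5 : Q ⊆ R.1 <;> by_cases h6 : R.1 ⊆ S.1 <;> simp [h5, h6, inc]
    rw [h1]
    by_cases h : Q ⊆ S.1
    · rw [card_between h hQ, S.2]
      simp [inc, h]
    · simp only [inc, PiLp.smul_apply, h, if_false, smul_zero]
      rw [Nat.cast_eq_zero, Finset.card_eq_zero, Finset.filter_eq_empty_iff]
      rintro R - ⟨h8, h9⟩
      exact h (h8.trans h9)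
  have hpos : ((k - Q.card).choose (s - Q.card) : ℂ) ≠ 0 :=
    Nat.cast_ne_zero.2 (Nat.choose_pos (by omega)).ne'
  refine (Submodule.smul_mem_iff _ hpos).1 ?_
  rw [← key]
  refine Submodule.sum_mem _ fun R _ => ?_
  split_ifs
  · exact Submodule.subset_span ⟨R, rfl⟩
  · exact Submodule.zero_mem _

lemma finrank_lowSpan_le {n k s : ℕ} (hs : s ≤ k) :
    Module.finrank ℂ (lowSpan n k (s + 1)) ≤ n.choose s := by
  have h1 : lowSpan n k (s + 1) ≤ Submodule.span ℂ (Set.range fun R : KSet n s => inc n k R.1) := by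
    refine Submodule.span_le.2 ?_
    rintro _ ⟨Q, hQ, rfl⟩
    exact inc_mem_span_card hs Q (by omega)
  refine (Submodule.finrank_mono h1).trans ?_
  rw [← card_kset]
  exact finrank_range_le_card _

lemma choose_sub_antitone {n k : ℕ} (hnk : 2 * k ≤ n) {s t : ℕ} (hst : s ≤ t) (ht : t ≤ k) :
    (n - k - t).choose (k - t) ≤ (n - k - s).choose (k - s) := by
  induction t, hst using Nat.le_induction with
  | base => exact le_rfl
  | succ t hst ih =>
    refine le_trans ?_ (ih (by omega))
    rw [show n - k - t = (n - k - (t + 1)) + 1 by omega,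
      show k - t = (k - (t + 1)) + 1 by omega, Nat.choose_succ_succ]
    omega

/-- The eigenvalues beyond the first `n.choose r` have absolute value at most that of the
`(r+1)`-st distinct one. -/
lemma abs_eigenvalue_le {n k : ℕ} (hnk : 2 * k ≤ n)
    {V : OrthonormalBasis (Fin (n.choose k)) ℂ (SetReg n k)} {lam : Fin (n.choose k) → ℝ}
    (hV : IsOrderedEigenbasis V lam) {r : ℕ} (hr : r < k) {j : Fin (n.choose k)}
    (hj : n.choose r ≤ j) :
    |lam j| ≤ ((n - k - (r + 1)).choose (k - (r + 1)) : ℝ) := by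
  by_contra! hlt
  -- If $|\lambda_j|$ were too large, the first $j+1>\binom nr$ eigenvectors would all lie in a
  -- space of dimension at most $\binom nr$.
  have hmem : ∀ i : Fin (j + 1 : ℕ), V ⟨i, by omega⟩ ∈ lowSpan n k (r + 1) := by
    intro i
    refine eigenvector_mem_lowSpan (by omega) (hV.2 _) fun s hs hsk => ?_
    have h2 : |lam j| ≤ |lam ⟨i, by omega⟩| := hV.1 _ _ (Fin.le_def.2 (by simp; omega))
    refine lt_of_le_of_lt ?_ (hlt.trans_le h2)
    exact_mod_cast choose_sub_antitone hnk hs hsk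
  have hli : LinearIndependent ℂ fun i : Fin (j + 1 : ℕ) => V ⟨i, by omega⟩ := by
    refine V.orthonormal.linearIndependent.comp _ fun a b hab => ?_
    simpa [Fin.ext_iff] using hab
  have hli' : LinearIndependent ℂ
      fun i : Fin (j + 1 : ℕ) => (⟨V ⟨i, by omega⟩, hmem i⟩ : lowSpan n k (r + 1)) :=
    LinearIndependent.of_comp (lowSpan n k (r + 1)).subtype hli
  have := hli'.fintype_card_le_finrank
  rw [Fintype.card_fin] at this
  have := finrank_lowSpan_le (n := n) hr.le
  omega

/-- The largest eigenvalue is at least the degree of the disjointness graph. -/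
lemma le_abs_eigenvalue_zero {n k : ℕ} (hnk : 2 * k ≤ n)
    {V : OrthonormalBasis (Fin (n.choose k)) ℂ (SetReg n k)} {lam : Fin (n.choose k) → ℝ}
    (hV : IsOrderedEigenbasis V lam) {j : Fin (n.choose k)} (hj : (j : ℕ) = 0) :
    ((n - k).choose k : ℝ) ≤ |lam j| := by
  have h1 : Matrix.toEuclideanLin (disjMatrix n k) (inc n k ∅) =
      ((n - k).choose k : ℂ) • inc n k ∅ := by
    rw [toEuclideanLin_inc (by simp)]; simp
  have hne : inc n k ∅ ≠ 0 := by
    intro h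
    -- `inc n k ∅` is the all-ones vector, an eigenvector whose eigenvalue is the degree.
    have h2 : Nonempty (KSet n k) := by
      rw [← Fintype.card_pos_iff, card_kset]; exact Nat.choose_pos (by omega)
    obtain ⟨S⟩ := h2
    have := congrArg (fun f : SetReg n k => f S) h
    simp [inc] at this
  obtain ⟨i, hi⟩ : ∃ i, V.repr (inc n k ∅) i ≠ 0 := by
    by_contra! h
    refine hne (V.repr.injective ?_)
    ext i; simp [h i]
  have h3 : V.repr (Matrix.toEuclideanLin (disjMatrix n k) (inc n k ∅)) i =
      (lam i : ℂ) * V.repr (inc n k ∅) i := by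
    conv_lhs => rw [← V.sum_repr (inc n k ∅)]
    simp only [map_sum, map_smul, hV.2, OrthonormalBasis.repr_self, WithLp.ofLp_sum,
      Finset.sum_apply, PiLp.smul_apply, PiLp.single_apply, smul_eq_mul]
    rw [Finset.sum_eq_single i]
    · simp; ring
    · intro b _ hb; simp [hb.symm]
    · simp
  rw [h1, map_smul, PiLp.smul_apply, smul_eq_mul] at h3
  have h4 : lam i = ((n - k).choose k : ℝ) := by
    have := mul_right_cancel₀ hi h3
    have h5 : ((lam i : ℝ) : ℂ) = (((n - k).choose k : ℝ) : ℂ) := by rw [← this]; simp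
    exact Complex.ofReal_injective h5
  rw [← Nat.abs_cast (R := ℝ), ← h4]
  exact hV.1 _ _ (Fin.le_def.2 (by omega))

/-! ### The state as a diagonal tensor, and the overlaps of its truncations. -/

/-- The vector `∑ j, a j • v j ⊗ v j`. -/
noncomputable def diagTensor {ι E : Type*} [Fintype ι] [NormedAddCommGroup E]
    [InnerProductSpace ℂ E] (v : ι → E) (a : ι → ℝ) : E ⊗[ℂ] E :=
  ∑ j, (a j : ℂ) • (v j ⊗ₜ[ℂ] v j)

section DiagTensor

variable {ι E F : Type*} [Fintype ι] [NormedAddCommGroup E] [InnerProductSpace ℂ E]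
  [NormedAddCommGroup F] [InnerProductSpace ℂ F]

lemma tensor_inner_smul_left (a : ℂ) (x y : E ⊗[ℂ] E) :
    inner ℂ (a • x) y = (starRingEnd ℂ) a * inner ℂ x y := inner_smul_left x y a

lemma tensor_inner_smul_right (a : ℂ) (x y : E ⊗[ℂ] E) :
    inner ℂ x (a • y) = a * inner ℂ x y := inner_smul_right x y a

lemma inner_diagTensor {v : ι → E} (hv : Orthonormal ℂ v) (a b : ι → ℝ) :
    inner ℂ (diagTensor v a) (diagTensor v b) = ((∑ j, a j * b j : ℝ) : ℂ) := by
  classical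
  simp only [diagTensor, sum_inner, inner_sum, tensor_inner_smul_left, tensor_inner_smul_right,
    TensorProduct.inner_tmul, orthonormal_iff_ite.1 hv, Complex.conj_ofReal]
  push_cast
  refine Finset.sum_congr rfl fun i _ => ?_
  rw [Finset.sum_eq_single i]
  · simp; ring
  · intro j _ hj; simp [hj]
  · simp

lemma norm_sq_diagTensor {v : ι → E} (hv : Orthonormal ℂ v) (a : ι → ℝ) :
    ‖diagTensor v a‖ ^ 2 = ∑ j, a j ^ 2 := by
  have h := inner_self_eq_norm_sq_to_K (𝕜 := ℂ) (diagTensor v a)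
  rw [inner_diagTensor hv] at h
  have h' : (((∑ j, a j * a j : ℝ)) : ℂ) = ((‖diagTensor v a‖ ^ 2 : ℝ) : ℂ) := by
    rw [h]; push_cast; rfl
  rw [← Complex.ofReal_injective h']
  simp [sq]

lemma map_diagTensor (f g : E →ₗ[ℂ] F) (v : ι → E) (w : ι → F) (a : ι → ℝ)
    (hf : ∀ j, a j ≠ 0 → f (v j) = w j) (hg : ∀ j, a j ≠ 0 → g (v j) = w j) :
    TensorProduct.map f g (diagTensor v a) = diagTensor w a := by
  simp only [diagTensor, map_sum, map_smul, TensorProduct.map_tmul]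
  refine Finset.sum_congr rfl fun j _ => ?_
  by_cases h : a j = 0
  · simp [h]
  · rw [hf j h, hg j h]

lemma diagTensor_sub (v : ι → E) (a b : ι → ℝ) :
    diagTensor v a - diagTensor v b = diagTensor v (a - b) := by
  simp [diagTensor, ← Finset.sum_sub_distrib, sub_smul]

end DiagTensor

/-- The coordinate vectors of `V` are real. -/
def IsRealBasis {n k : ℕ} (V : OrthonormalBasis (Fin (n.choose k)) ℂ (SetReg n k)) : Prop :=
  ∀ j S, (starRingEnd ℂ) (V j S) = V j S

/-- The real symmetric matrix is diagonalized over $\mathbb R$ and its eigenvectors complexified.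
Reality matters: for a general complex eigenbasis the expansion of $|\chi\rangle$ would pair $v_j$
with its conjugate. -/
lemma exists_real_orderedEigenbasis (n k : ℕ) (h : k ≤ n) :
    ∃ (V : OrthonormalBasis (Fin (n.choose k)) ℂ (SetReg n k)) (lam : Fin (n.choose k) → ℝ),
      IsOrderedEigenbasis V lam ∧ IsRealBasis V := by
  let A : Matrix (KSet n k) (KSet n k) ℝ :=
    Matrix.of fun S T => if Disjoint S.1 T.1 then 1 else 0
  have hA : A.IsHermitian := by
    ext S T
    simp [A, disjoint_comm]
  let e₀ : Fin (n.choose k) ≃ KSet n k := (Fintype.equivFinOfCardEq (card_kset n k)).symm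
  let f : Fin (n.choose k) → ℝ := fun j => -|hA.eigenvalues (e₀ j)|
  let e : Fin (n.choose k) ≃ KSet n k := (Tuple.sort f).trans e₀
  let v : Fin (n.choose k) → SetReg n k := fun j =>
    WithLp.toLp 2 fun S => ((hA.eigenvectorBasis (e j) S : ℝ) : ℂ)
  have hv : Orthonormal ℂ v := by
    rw [orthonormal_iff_ite]
    intro i j
    have h1 := orthonormal_iff_ite.1 hA.eigenvectorBasis.orthonormal (e i) (e j)
    simp only [EmbeddingLike.apply_eq_iff_eq] at h1
    simp only [PiLp.inner_apply, v] at h1 ⊢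
    have h2 : ∀ S, inner ℂ ((hA.eigenvectorBasis (e i) S : ℝ) : ℂ)
        ((hA.eigenvectorBasis (e j) S : ℝ) : ℂ) =
        ((inner ℝ (hA.eigenvectorBasis (e i) S) (hA.eigenvectorBasis (e j) S) : ℝ) : ℂ) := by
      intro S; simp
    rw [Finset.sum_congr rfl fun S _ => h2 S, ← Complex.ofReal_sum, h1]
    split_ifs <;> simp
  have : Nonempty (Fin (n.choose k)) := ⟨⟨0, Nat.choose_pos h⟩⟩
  let b := basisOfOrthonormalOfCardEqFinrank hv (by simp)
  have hb : ⇑b = v := coe_basisOfOrthonormalOfCardEqFinrank hv _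
  let V : OrthonormalBasis (Fin (n.choose k)) ℂ (SetReg n k) :=
    b.toOrthonormalBasis (hb ▸ hv)
  have hV : ∀ j, V j = v j := fun j => by simp [V, hb]
  refine ⟨V, fun j => hA.eigenvalues (e j), ⟨fun i j hij => ?_, fun j => ?_⟩, fun j S => ?_⟩
  · exact neg_le_neg_iff.1 (Tuple.monotone_sort f hij)
  · rw [hV]
    ext S
    have h1 := congrFun (hA.mulVec_eigenvectorBasis (e j)) S
    rw [Matrix.toLpLin_apply]
    simp only [PiLp.smul_apply, smul_eq_mul, v, Pi.smul_apply, Matrix.mulVec, dotProduct] at h1 ⊢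
    rw [← Complex.ofReal_mul, ← h1]
    push_cast
    refine Finset.sum_congr rfl fun T _ => ?_
    congr 1
    simp only [disjMatrix, A, Matrix.of_apply]
    split_ifs <;> simp
  · rw [hV]; simp [v]

lemma numDisjoint_eq {n k : ℕ} : numDisjoint n k = n.choose k * (n - k).choose k := by
  rw [numDisjoint, Finset.card_filter, Fintype.sum_prod_type]
  have : ∀ S : KSet n k, ∑ T : KSet n k, (if Disjoint S.1 T.1 then 1 else 0) =
      (n - k).choose k := by
    intro S
    have h1 := card_between (k := k) (Q := ∅) (A := S.1ᶜ) (by simp) (by simp)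
    rw [Finset.card_compl, S.2, Fintype.card_fin, Finset.card_empty, Nat.sub_zero,
      Nat.sub_zero] at h1
    rw [← h1, ← Finset.card_filter]
    congr 1
    ext T
    simp [Finset.subset_compl_iff_disjoint_left]
  rw [Finset.sum_congr rfl fun S _ => this S, Finset.sum_const, Finset.card_univ, card_kset,
    smul_eq_mul]

lemma numDisjoint_pos {n k : ℕ} (h : 2 * k ≤ n) : 0 < numDisjoint n k := by
  rw [numDisjoint_eq]
  exact Nat.mul_pos (Nat.choose_pos (by omega)) (Nat.choose_pos (by omega))

/-- The coefficients `λ_j` with `j < t`. -/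
noncomputable def headCoeff {n k : ℕ} (lam : Fin (n.choose k) → ℝ) (t : ℕ)
    (j : Fin (n.choose k)) : ℝ :=
  if (j : ℕ) < t then lam j / Real.sqrt (numDisjoint n k) else 0

section

variable {n k : ℕ} {V : OrthonormalBasis (Fin (n.choose k)) ℂ (SetReg n k)}
  {lam : Fin (n.choose k) → ℝ}

lemma disjMatrix_ket (S : KSet n k) :
    Matrix.toEuclideanLin (disjMatrix n k) (ket S) =
      ∑ T : KSet n k, if Disjoint S.1 T.1 then ket T else 0 := by
  ext U
  rw [Matrix.toLpLin_apply]
  simp only [WithLp.ofLp_sum, Finset.sum_apply]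
  have : ∀ T : KSet n k, (if Disjoint S.1 T.1 then ket T else (0 : SetReg n k)) U =
      if U = T then (if Disjoint S.1 T.1 then 1 else 0) else 0 := by
    intro T
    split_ifs <;> simp_all [ket]
  rw [Finset.sum_congr rfl fun T _ => this T]
  simp [ket, disjMatrix, Matrix.mulVec, dotProduct, disjoint_comm]

/-- Up to normalization $|\chi\rangle=\sum_S|S\rangle\otimes M|S\rangle$; expanding the second
factor in $V$ and resumming over $S$ gives $v_j$ in the first, the conjugates being removed by `hR`.
-/
lemma chi_eq_diagTensor (hV : IsOrderedEigenbasis V lam) (hR : IsRealBasis V) :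
    chi n k = diagTensor V fun j => lam j / Real.sqrt (numDisjoint n k) := by
  have h1 : ∀ S : KSet n k, (∑ T : KSet n k,
      if Disjoint S.1 T.1 then ket S ⊗ₜ[ℂ] ket T else (0 : SetReg n k ⊗[ℂ] SetReg n k)) =
      ∑ j, ((lam j : ℂ) * V j S) • (ket S ⊗ₜ[ℂ] V j) := by
    intro S
    have h2 : ket S = ∑ j, V j S • V j := by
      conv_lhs => rw [← V.sum_repr (ket S)]
      refine Finset.sum_congr rfl fun j _ => ?_
      rw [OrthonormalBasis.repr_apply_apply, ket, EuclideanSpace.inner_single_right, hR j S,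
        one_mul]
    have h3 : Matrix.toEuclideanLin (disjMatrix n k) (ket S) =
        ∑ j, ((lam j : ℂ) * V j S) • V j := by
      rw [h2]
      simp only [map_sum, map_smul, hV.2, smul_smul]
      exact Finset.sum_congr rfl fun j _ => by rw [mul_comm]
    rw [disjMatrix_ket] at h3
    have h4 := congrArg (fun x => ket S ⊗ₜ[ℂ] x) h3
    simp only [TensorProduct.tmul_sum, TensorProduct.tmul_smul] at h4
    rw [← h4]
    exact Finset.sum_congr rfl fun T _ => by split_ifs <;> simp
  rw [chi, Finset.sum_congr rfl fun S _ => h1 S, Finset.sum_comm, Finset.smul_sum, diagTensor]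
  refine Finset.sum_congr rfl fun j _ => ?_
  have h5 : V j = ∑ S, V j S • ket S := by
    conv_lhs => rw [← (EuclideanSpace.basisFun (KSet n k) ℂ).sum_repr (V j)]
    simp [ket]
  have h6 : V j ⊗ₜ[ℂ] V j = ∑ S, V j S • (ket S ⊗ₜ[ℂ] V j) := by
    conv_lhs => rw [h5]
    simp only [TensorProduct.sum_tmul, TensorProduct.smul_tmul']
    refine Finset.sum_congr rfl fun S _ => ?_
    rw [← h5]
  rw [h6]
  simp only [Finset.smul_sum, smul_smul]
  refine Finset.sum_congr rfl fun S _ => ?_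
  congr 1
  push_cast
  ring

lemma norm_chi (h : 2 * k ≤ n) : ‖chi n k‖ = 1 := by
  have hD : (0 : ℝ) < numDisjoint n k := Nat.cast_pos.2 (numDisjoint_pos h)
  have h1 : inner ℂ (∑ S : KSet n k, ∑ T : KSet n k,
      if Disjoint S.1 T.1 then ket S ⊗ₜ[ℂ] ket T else (0 : SetReg n k ⊗[ℂ] SetReg n k))
      (∑ S : KSet n k, ∑ T : KSet n k,
      if Disjoint S.1 T.1 then ket S ⊗ₜ[ℂ] ket T else (0 : SetReg n k ⊗[ℂ] SetReg n k)) =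
      (numDisjoint n k : ℂ) := by
    rw [numDisjoint, Finset.card_filter, Fintype.sum_prod_type]
    push_cast
    rw [← Fintype.sum_prod_type' fun S T : KSet n k => if Disjoint S.1 T.1 then
      ket S ⊗ₜ[ℂ] ket T else (0 : SetReg n k ⊗[ℂ] SetReg n k)]
    rw [← Fintype.sum_prod_type' fun S T : KSet n k => if Disjoint S.1 T.1 then (1 : ℂ) else 0]
    simp only [sum_inner, inner_sum]
    refine Finset.sum_congr rfl fun p _ => ?_
    rw [Finset.sum_eq_single p]
    · split_ifs <;> simp [ket]
    · intro q _ hq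
      split_ifs
      · rw [TensorProduct.inner_tmul]
        simp only [ket, EuclideanSpace.inner_single_left, PiLp.single_apply, map_one, one_mul]
        by_cases h3 : p.1 = q.1
        · have h4 : ¬ p.2 = q.2 := fun h4 => hq (Prod.ext h3.symm h4.symm)
          simp [h4, eq_comm]
        · simp [h3, eq_comm]
      all_goals simp
    · simp
  have h2 := inner_self_eq_norm_sq_to_K (𝕜 := ℂ) (∑ S : KSet n k, ∑ T : KSet n k,
      if Disjoint S.1 T.1 then ket S ⊗ₜ[ℂ] ket T else (0 : SetReg n k ⊗[ℂ] SetReg n k))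
  rw [h1] at h2
  have h3 : ‖∑ S : KSet n k, ∑ T : KSet n k,
      if Disjoint S.1 T.1 then ket S ⊗ₜ[ℂ] ket T else (0 : SetReg n k ⊗[ℂ] SetReg n k)‖ =
      Real.sqrt (numDisjoint n k) := by
    rw [eq_comm, Real.sqrt_eq_iff_mul_self_eq hD.le (norm_nonneg _), ← sq]
    apply Complex.ofReal_injective
    rw [Complex.ofReal_pow, Complex.ofReal_natCast]
    exact h2
  rw [chi, norm_smul, h3, norm_inv, Complex.norm_real, Real.norm_of_nonneg (Real.sqrt_nonneg _),
    inv_mul_cancel₀ (Real.sqrt_pos.2 hD).ne']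

lemma sum_sq_eigenvalue (hV : IsOrderedEigenbasis V lam) (hR : IsRealBasis V) (h : 2 * k ≤ n) :
    ∑ j, lam j ^ 2 = numDisjoint n k := by
  have hD : (0 : ℝ) < numDisjoint n k := Nat.cast_pos.2 (numDisjoint_pos h)
  have h1 := norm_sq_diagTensor V.orthonormal fun j => lam j / Real.sqrt (numDisjoint n k)
  rw [← chi_eq_diagTensor hV hR, norm_chi h] at h1
  simp only [div_pow, Real.sq_sqrt hD.le] at h1
  rw [← Finset.sum_div, one_pow, eq_div_iff hD.ne', one_mul] at h1
  exact h1.symm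

lemma starProjection_chi (hV : IsOrderedEigenbasis V lam) (hR : IsRealBasis V) (t : ℕ) :
    (topSpan V t).starProjection (chi n k) = diagTensor V (headCoeff lam t) := by
  refine Submodule.eq_starProjection_of_mem_of_inner_eq_zero ?_ ?_
  · refine Submodule.sum_mem _ fun j _ => ?_
    by_cases hj : (j : ℕ) < t
    · exact Submodule.smul_mem _ _ (Submodule.subset_span ⟨j, j, hj, hj, rfl⟩)
    · simp [headCoeff, hj]
  -- The remainder involves only $v_l\otimes v_l$ with $l\ge t$, orthogonal to every generator of
  -- the top span.
  · rw [chi_eq_diagTensor hV hR, diagTensor_sub]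
    intro w hw
    induction hw using Submodule.span_induction with
    | zero => simp
    | add x y _ _ hx hy => rw [inner_add_right, hx, hy, add_zero]
    | smul a x _ hx => rw [tensor_inner_smul_right, hx, mul_zero]
    | mem x hx =>
      obtain ⟨i, j, hi, hj, rfl⟩ := hx
      rw [diagTensor, sum_inner]
      refine Finset.sum_eq_zero fun l _ => ?_
      rw [tensor_inner_smul_left, TensorProduct.inner_tmul, orthonormal_iff_ite.1 V.orthonormal]
      by_cases h : l = i
      · subst h; simp [headCoeff, hi]
      · simp [h]

lemma rotate_psi (hV : IsOrderedEigenbasis V lam) (hR : IsRealBasis V) (t : ℕ) :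
    rotate V (psi V t) = diagTensor V (headCoeff lam t) := by
  rw [psi, LinearIsometryEquiv.apply_symm_apply, starProjection_chi hV hR]

lemma sum_sq_headCoeff (hV : IsOrderedEigenbasis V lam) (hR : IsRealBasis V) (h : 2 * k ≤ n)
    (t : ℕ) : ∑ j, headCoeff lam t j ^ 2 = 1 - tail lam t := by
  have hD : (0 : ℝ) < numDisjoint n k := Nat.cast_pos.2 (numDisjoint_pos h)
  rw [eq_sub_iff_add_eq, tail, ← Finset.sum_add_distrib, ← div_self hD.ne']
  conv_rhs => rw [← sum_sq_eigenvalue hV hR h, Finset.sum_div]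
  refine Finset.sum_congr rfl fun j _ => ?_
  rw [headCoeff, sum_sq_eigenvalue hV hR h]
  rcases lt_or_ge (j : ℕ) t with h1 | h1
  · rw [if_pos h1, if_neg h1.not_ge, div_pow, Real.sq_sqrt hD.le, add_zero]
  · rw [if_neg h1.not_gt, if_pos h1]; simp

lemma inner_chi_diagTensor (hV : IsOrderedEigenbasis V lam) (hR : IsRealBasis V) (h : 2 * k ≤ n)
    (t : ℕ) : inner ℂ (chi n k) (diagTensor V (headCoeff lam t)) = ((1 - tail lam t : ℝ) : ℂ) := by
  rw [chi_eq_diagTensor hV hR, inner_diagTensor V.orthonormal, ← sum_sq_headCoeff hV hR h]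
  congr 1
  refine Finset.sum_congr rfl fun j _ => ?_
  rw [headCoeff]
  split_ifs <;> ring

lemma norm_chi_sub (hV : IsOrderedEigenbasis V lam) (hR : IsRealBasis V) (t : ℕ) :
    ‖chi n k - rotate V (psi V t)‖ ^ 2 = tail lam t := by
  rw [rotate_psi hV hR, chi_eq_diagTensor hV hR, diagTensor_sub,
    norm_sq_diagTensor V.orthonormal, tail]
  refine Finset.sum_congr rfl fun j _ => ?_
  rcases lt_or_ge (j : ℕ) t with h1 | h1
  · simp [headCoeff, h1, h1.not_ge]
  · simp [headCoeff, h1, h1.not_gt, div_pow]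

lemma norm_psi (hV : IsOrderedEigenbasis V lam) (hR : IsRealBasis V) (h : 2 * k ≤ n) (t : ℕ) :
    ‖psi V t‖ = Real.sqrt (1 - tail lam t) := by
  rw [← LinearIsometryEquiv.norm_map (rotate V), rotate_psi hV hR, ← sum_sq_headCoeff hV hR h,
    ← norm_sq_diagTensor V.orthonormal, Real.sqrt_sq (norm_nonneg _)]

lemma inner_chi_psi (hV : IsOrderedEigenbasis V lam) (hR : IsRealBasis V) (h : 2 * k ≤ n)
    (t : ℕ) : (inner ℂ (chi n k) (rotate V (psi V t))).re = 1 - tail lam t := by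
  rw [rotate_psi hV hR, inner_chi_diagTensor hV hR h, Complex.ofReal_re]

lemma inner_chi_pureState (hV : IsOrderedEigenbasis V lam) (hR : IsRealBasis V) (h : 2 * k ≤ n)
    (t : ℕ) : (inner ℂ (chi n k) (rotate V (pureState (psi V t)))).re =
      Real.sqrt (1 - tail lam t) := by
  rw [pureState, map_smul, tensor_inner_smul_right, rotate_psi hV hR, inner_chi_diagTensor hV hR h,
    norm_psi hV hR h, ← Complex.ofReal_inv, ← Complex.ofReal_mul, Complex.ofReal_re,
    inv_mul_eq_div, Real.div_sqrt]

end

/-! ### Tail bounds by level weights. -/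

/-- An upper bound for the share of `‖M‖_F²` that the `s`-th eigenspace of the disjointness
matrix carries. -/
noncomputable def levelWeight (n k s : ℕ) : ℝ :=
  n.choose s * ((n - k - s).choose (k - s) : ℝ) ^ 2 / (n.choose k * (n - k).choose k)

lemma levelWeight_nonneg (n k s : ℕ) : 0 ≤ levelWeight n k s := by
  unfold levelWeight; positivity

lemma choose_le_pow (n r : ℕ) : n.choose r ≤ n ^ r := by
  rcases Nat.lt_or_ge n r with h | h
  · rw [Nat.choose_eq_zero_of_lt h]; exact Nat.zero_le _
  · exact (Nat.choose_le_pow_div r n (α := ℝ)).trans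
      (div_le_self (by positivity) (by exact_mod_cast Nat.factorial_pos r)) |> fun h => by
        exact_mod_cast h

section

variable {n k : ℕ} {V : OrthonormalBasis (Fin (n.choose k)) ℂ (SetReg n k)}
  {lam : Fin (n.choose k) → ℝ}

lemma tail_eq_zero {t : ℕ} (h : n.choose k ≤ t) : tail lam t = 0 :=
  Finset.sum_eq_zero fun j _ => if_neg (by omega)

lemma tail_nonneg (t : ℕ) : 0 ≤ tail lam t :=
  Finset.sum_nonneg fun j _ => by split_ifs <;> positivity

lemma tail_le_sum_levelWeight (hnk : 2 * k ≤ n) (hn : 1 ≤ n) (hV : IsOrderedEigenbasis V lam)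
    {r t : ℕ} (ht : n ^ r ≤ t) : tail lam t ≤ ∑ s ∈ Finset.Ioc r k, levelWeight n k s := by
  rcases Nat.lt_or_ge r k with hr | hr
  swap
  · rw [tail_eq_zero ((choose_le_pow n k).trans ((Nat.pow_le_pow_right hn hr).trans ht))]
    exact Finset.sum_nonneg fun s _ => levelWeight_nonneg n k s
  have hD : (0 : ℝ) < numDisjoint n k := Nat.cast_pos.2 (numDisjoint_pos hnk)
  have h1 : ∀ j : Fin (n.choose k), (if t ≤ (j : ℕ) then lam j ^ 2 / (numDisjoint n k : ℝ) else 0) ≤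
      ∑ s ∈ Finset.Ioc r k, if (j : ℕ) < n.choose s then
        ((n - k - s).choose (k - s) : ℝ) ^ 2 / (numDisjoint n k : ℝ) else 0 := by
    intro j
    have hnn : ∀ s ∈ Finset.Ioc r k, 0 ≤ if (j : ℕ) < n.choose s then
        ((n - k - s).choose (k - s) : ℝ) ^ 2 / (numDisjoint n k : ℝ) else 0 := by
      intro s _; split_ifs <;> positivity
    split_ifs with hj
    swap
    · exact Finset.sum_nonneg hnn
    -- The index $j$ is charged to the least level $s>r$ with $j<\binom ns$. Then $j\ge\binom
    -- n{s-1}$, by minimality or, if $s-1=r$, by $j\ge t\ge n^r$, so the eigenvalue bound of level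
    -- $s$ applies.
    have hex : ∃ s, r < s ∧ (j : ℕ) < n.choose s := ⟨k, hr, j.2⟩
    classical
    have hs := Nat.find_spec hex
    have hsk : Nat.find hex ≤ k := Nat.find_min' hex ⟨hr, j.2⟩
    have hmin := fun m => Nat.find_min hex (m := m)
    generalize Nat.find hex = s at hs hsk hmin
    have hj' : n.choose (s - 1) ≤ j := by
      rcases Nat.lt_or_ge r (s - 1) with h | h
      · have := hmin (s - 1) (by omega)
        push Not at this
        exact this h
      · rw [show s - 1 = r by omega]
        exact (choose_le_pow n r).trans (ht.trans hj)
    have h2 := abs_eigenvalue_le hnk hV (r := s - 1) (by omega) hj'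
    rw [show s - 1 + 1 = s by omega] at h2
    refine le_trans ?_ (Finset.single_le_sum hnn (Finset.mem_Ioc.2 ⟨hs.1, hsk⟩))
    rw [if_pos hs.2, ← sq_abs (lam j)]
    gcongr
  refine (Finset.sum_le_sum fun j _ => h1 j).trans ?_
  rw [Finset.sum_comm]
  refine Finset.sum_le_sum fun s _ => ?_
  rw [← Finset.sum_filter, Finset.sum_const, nsmul_eq_mul, levelWeight, mul_div_assoc,
    numDisjoint_eq, Nat.cast_mul]
  refine mul_le_mul_of_nonneg_right ?_ (by positivity)
  have h3 : (Finset.univ.filter fun j : Fin (n.choose k) => (j : ℕ) < n.choose s).card ≤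
      (Finset.range (n.choose s)).card := by
    refine Finset.card_le_card_of_injOn (fun j => (j : ℕ)) ?_ ?_
    · intro j hj; simpa using hj
    · intro a _ b _ hab; exact Fin.ext hab
  rw [Finset.card_range] at h3
  exact_mod_cast h3

lemma tail_add_head (hV : IsOrderedEigenbasis V lam) (hR : IsRealBasis V) (hnk : 2 * k ≤ n)
    (t : ℕ) : tail lam t + (∑ j : Fin (n.choose k), if (j : ℕ) < t then lam j ^ 2 else 0) /
      numDisjoint n k = 1 := by
  have hD : (0 : ℝ) < numDisjoint n k := Nat.cast_pos.2 (numDisjoint_pos hnk)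
  rw [tail, Finset.sum_div, ← Finset.sum_add_distrib, ← div_self hD.ne']
  conv_rhs => rw [← sum_sq_eigenvalue hV hR hnk, Finset.sum_div]
  refine Finset.sum_congr rfl fun j _ => ?_
  rw [sum_sq_eigenvalue hV hR hnk]
  rcases lt_or_ge (j : ℕ) t with h1 | h1
  · rw [if_pos h1, if_neg h1.not_ge, zero_add]
  · rw [if_neg h1.not_gt, if_pos h1]; simp

lemma levelWeight_zero (hnk : 2 * k ≤ n) :
    levelWeight n k 0 = (n - k).choose k / n.choose k := by
  have h1 : (0 : ℝ) < n.choose k := Nat.cast_pos.2 (Nat.choose_pos (by omega))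
  have h2 : (0 : ℝ) < (n - k).choose k := Nat.cast_pos.2 (Nat.choose_pos (by omega))
  simp only [levelWeight, Nat.choose_zero_right, Nat.sub_zero]
  field_simp
  simp

lemma tail_le_one_sub (hV : IsOrderedEigenbasis V lam) (hR : IsRealBasis V) (hnk : 2 * k ≤ n)
    {t : ℕ} (ht : 1 ≤ t) : tail lam t ≤ 1 - levelWeight n k 0 := by
  have hD : (0 : ℝ) < numDisjoint n k := Nat.cast_pos.2 (numDisjoint_pos hnk)
  have h1 := tail_add_head hV hR hnk t
  have hN : 0 < n.choose k := Nat.choose_pos (by omega)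
  have h2 : ((n - k).choose k : ℝ) ^ 2 ≤ ∑ j : Fin (n.choose k),
      if (j : ℕ) < t then lam j ^ 2 else 0 := by
    refine le_trans ?_ (Finset.single_le_sum (fun j _ => ?_) (Finset.mem_univ ⟨0, hN⟩))
    · rw [if_pos (show 0 < t from ht), ← sq_abs (lam _)]
      gcongr
      exact le_abs_eigenvalue_zero hnk hV rfl
    · split_ifs <;> positivity
  have h3 : levelWeight n k 0 = ((n - k).choose k : ℝ) ^ 2 / numDisjoint n k := by
    rw [levelWeight, numDisjoint_eq]; simp
  have h4 : ((n - k).choose k : ℝ) ^ 2 / numDisjoint n k ≤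
    (∑ j : Fin (n.choose k), if (j : ℕ) < t then lam j ^ 2 else 0) / numDisjoint n k := by gcongr
  rw [h3]; linarith

/-- The partial sums of the decreasing sequence `λ_j²` are concave. -/
lemma one_sub_tail_ge (hV : IsOrderedEigenbasis V lam) (hR : IsRealBasis V) (hnk : 2 * k ≤ n)
    {t m : ℕ} (htm : t ≤ m) (hm : m ≤ n.choose k) :
    t * (1 - tail lam m) ≤ m * (1 - tail lam t) := by
  have hD : (0 : ℝ) < numDisjoint n k := Nat.cast_pos.2 (numDisjoint_pos hnk)
  rcases htm.eq_or_lt with rfl | htm'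
  · exact le_rfl
  have ht : t < n.choose k := by omega
  -- The squared eigenvalue at index $t$ separates the two ranges: earlier terms are at least `a`,
  -- later ones at most `a`.
  set a := lam ⟨t, ht⟩ ^ 2
  have hle : ∀ i j : Fin (n.choose k), i ≤ j → lam j ^ 2 ≤ lam i ^ 2 := fun i j h =>
    sq_le_sq.2 (hV.1 i j h)
  have hcard : ∀ u, u ≤ n.choose k →
      (Finset.univ.filter fun j : Fin (n.choose k) => (j : ℕ) < u).card = u := by
    intro u hu
    rw [Fin.card_filter_val_lt, min_eq_right hu]
  have h1 : t * a ≤ ∑ j : Fin (n.choose k), if (j : ℕ) < t then lam j ^ 2 else 0 := by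
    rw [← Finset.sum_filter, ← nsmul_eq_mul]
    conv_lhs => rw [← hcard t (by omega)]
    refine Finset.card_nsmul_le_sum _ _ _ fun j hj => hle _ _ ?_
    rw [Finset.mem_filter] at hj
    exact Fin.le_def.2 hj.2.le
  have h2 : (∑ j : Fin (n.choose k), if (j : ℕ) < m then lam j ^ 2 else 0) ≤
      (∑ j : Fin (n.choose k), if (j : ℕ) < t then lam j ^ 2 else 0) + (m - t) * a := by
    have h3 : ∀ j : Fin (n.choose k), (if (j : ℕ) < m then lam j ^ 2 else 0) ≤
        (if (j : ℕ) < t then lam j ^ 2 else 0) +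
          ((if (j : ℕ) < m then a else 0) - (if (j : ℕ) < t then a else 0)) := by
      intro j
      rcases Nat.lt_or_ge j t with h | h
      · simp [h, h.trans htm']
      · have := hle ⟨t, ht⟩ j (Fin.le_def.2 h)
        by_cases h' : (j : ℕ) < m
        · simpa [h, h.not_gt, h'] using this
        · simp [h.not_gt, h']
    refine (Finset.sum_le_sum fun j _ => h3 j).trans ?_
    have h8 : ∀ u, u ≤ n.choose k →
        ∑ j : Fin (n.choose k), (if (j : ℕ) < u then a else 0) = u * a := by
      intro u hu
      rw [← Finset.sum_filter, Finset.sum_const, hcard u hu, nsmul_eq_mul]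
    rw [Finset.sum_add_distrib, Finset.sum_sub_distrib, h8 m hm, h8 t (by omega), sub_mul]
  have h4 := tail_add_head hV hR hnk t
  have h5 := tail_add_head hV hR hnk m
  have h6 : (t : ℝ) < m := by exact_mod_cast htm'
  have ht0 : (0 : ℝ) ≤ t := by positivity
  rw [← eq_sub_iff_add_eq'] at h4 h5
  rw [← h4, ← h5, ← mul_div_assoc, ← mul_div_assoc]
  refine div_le_div_of_nonneg_right ?_ hD.le
  linarith [mul_le_mul_of_nonneg_left h2 ht0, mul_le_mul_of_nonneg_left h1 (sub_nonneg.2 h6.le)]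

end

/-! ### Binomial ratios and explicit estimates for $k=\lfloor\sqrt n\rfloor$. -/

lemma cast_choose_pred {N K : ℕ} (hK : 0 < K) (hN : K ≤ N) :
    (N : ℝ) * ((N - 1).choose (K - 1) : ℝ) = K * (N.choose K : ℝ) := by
  obtain ⟨N, rfl⟩ := Nat.exists_eq_succ_of_ne_zero (by omega : N ≠ 0)
  obtain ⟨K, rfl⟩ := Nat.exists_eq_succ_of_ne_zero hK.ne'
  have := Nat.add_one_mul_choose_eq N K
  rw [mul_comm ((K.succ : ℕ) : ℝ)]
  simpa using congrArg (Nat.cast : ℕ → ℝ) this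

lemma levelWeight_succ {n k s : ℕ} (hnk : 2 * k ≤ n) (hs : s < k) :
    levelWeight n k (s + 1) = levelWeight n k s *
      ((n - s) * (k - s) ^ 2 / ((s + 1) * (n - k - s) ^ 2)) := by
  have h1 := cast_choose_pred (N := n - k - s) (K := k - s) (by omega) (by omega)
  rw [Nat.sub_sub _ s 1, Nat.sub_sub k s 1, Nat.cast_sub (by omega), Nat.cast_sub (by omega),
    Nat.cast_sub (by omega)] at h1
  have h2 : (n.choose (s + 1) : ℝ) * (s + 1) = n.choose s * (n - s) := by
    have := Nat.choose_succ_right_eq n s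
    rw [← Nat.cast_sub (by omega)]
    exact_mod_cast this
  have h3 : (0 : ℝ) < n - k - s := by
    have : ((k + s : ℕ) : ℝ) < n := Nat.cast_lt.2 (by omega)
    push_cast at this; linarith
  have h4 : ((n - k - (s + 1)).choose (k - (s + 1)) : ℝ) =
      (k - s) * ((n - k - s).choose (k - s) : ℝ) / (n - k - s) := by
    rw [eq_div_iff h3.ne', mul_comm]; exact h1
  have h5 : (n.choose (s + 1) : ℝ) = n.choose s * (n - s) / (s + 1) := by
    rw [eq_div_iff (by positivity)]; exact h2
  have h6 : (0 : ℝ) < n.choose k := Nat.cast_pos.2 (Nat.choose_pos (by omega))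
  have h7 : (0 : ℝ) < (n - k).choose k := Nat.cast_pos.2 (Nat.choose_pos (by omega))
  rw [levelWeight, levelWeight, h4, h5]
  field_simp

/-- Comparing the factors of `n (n-1) ⋯ (n-k+1)` and `(n-k) (n-k-1) ⋯ (n-2k+1)`. -/
lemma choose_le_pow_mul {n k : ℕ} (hnk : 2 * k ≤ n) {x : ℝ} (hx : 0 ≤ x)
    (h : (k : ℝ) ≤ x * (n - 2 * k + 1)) :
    (n.choose k : ℝ) ≤ (1 + x) ^ k * ((n - k).choose k : ℝ) := by
  have key : ∀ j, j ≤ k →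
      (n.descFactorial j : ℝ) ≤ (1 + x) ^ j * ((n - k).descFactorial j : ℝ) := by
    intro j
    induction j with
    | zero => simp
    | succ j ih =>
      intro hj
      rw [Nat.descFactorial_succ, Nat.descFactorial_succ, Nat.cast_mul, Nat.cast_mul,
        Nat.cast_sub (by omega), Nat.cast_sub (by omega), Nat.cast_sub (by omega)]
      have h1 : (j : ℝ) + 1 ≤ k := by exact_mod_cast hj
      have h2 : (2 * k : ℝ) ≤ n := by exact_mod_cast hnk
      have h3 : (n - j : ℝ) ≤ (1 + x) * (n - k - j) := by nlinarith
      calc (n - j : ℝ) * n.descFactorial j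
          ≤ ((1 + x) * (n - k - j)) * ((1 + x) ^ j * ((n - k).descFactorial j : ℝ)) :=
            mul_le_mul h3 (ih (by omega)) (by positivity) (by nlinarith)
        _ = _ := by ring
  have h4 := key k le_rfl
  rw [Nat.descFactorial_eq_factorial_mul_choose, Nat.descFactorial_eq_factorial_mul_choose,
    Nat.cast_mul, Nat.cast_mul, mul_left_comm] at h4
  exact le_of_mul_le_mul_left h4 (by positivity)

lemma pow_mul_choose_le {n k : ℕ} (hnk : 2 * k ≤ n) {x : ℝ} (hx : 0 ≤ x)
    (h : x * (n - k) ≤ k) :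
    (1 + x) ^ k * ((n - k).choose k : ℝ) ≤ n.choose k := by
  have key : ∀ j, j ≤ k →
      (1 + x) ^ j * ((n - k).descFactorial j : ℝ) ≤ n.descFactorial j := by
    intro j
    induction j with
    | zero => simp
    | succ j ih =>
      intro hj
      rw [Nat.descFactorial_succ, Nat.descFactorial_succ, Nat.cast_mul, Nat.cast_mul,
        Nat.cast_sub (by omega), Nat.cast_sub (by omega), Nat.cast_sub (by omega)]
      have h1 : (j : ℝ) + 1 ≤ k := by exact_mod_cast hj
      have h2 : (2 * k : ℝ) ≤ n := by exact_mod_cast hnk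
      have h0 : (0 : ℝ) ≤ j := by positivity
      have h3 : (1 + x) * (n - k - j) ≤ (n - j : ℝ) := by nlinarith [mul_nonneg hx h0]
      calc (1 + x) ^ (j + 1) * ((n - k - j : ℝ) * ((n - k).descFactorial j : ℝ))
          = ((1 + x) * (n - k - j)) * ((1 + x) ^ j * ((n - k).descFactorial j : ℝ)) := by ring
        _ ≤ _ := mul_le_mul h3 (ih (by omega)) (by positivity) (by nlinarith)
  have h4 := key k le_rfl
  rw [Nat.descFactorial_eq_factorial_mul_choose, Nat.descFactorial_eq_factorial_mul_choose,
    Nat.cast_mul, Nat.cast_mul, mul_left_comm] at h4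
  exact le_of_mul_le_mul_left h4 (by positivity)

lemma levelWeight_zero_ge_of_pow_le {n k : ℕ} (hnk : 2 * k ≤ n) {x B : ℝ} (hx : 0 ≤ x)
    (h : (k : ℝ) ≤ x * (n - 2 * k + 1)) (hB : (1 + x) ^ k ≤ B) : 1 / B ≤ levelWeight n k 0 := by
  have h1 : (0 : ℝ) < n.choose k := Nat.cast_pos.2 (Nat.choose_pos (by omega))
  have hB0 : 0 < B := lt_of_lt_of_le (by positivity) hB
  rw [levelWeight_zero hnk, div_le_div_iff₀ hB0 h1, one_mul]
  calc _ ≤ _ := choose_le_pow_mul hnk hx h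
    _ ≤ B * ((n - k).choose k : ℝ) := by gcongr
    _ = _ := mul_comm _ _

lemma one_add_pow_le_four {k : ℕ} (hk : 6 ≤ k) : (1 + k / ((k : ℝ) - 1) ^ 2) ^ k ≤ 4 := by
  -- The bound $\exp(k^2/(k-1)^2)$ used below is already greater than $4$ at $k=6$, so that case is
  -- computed directly.
  rcases hk.eq_or_lt with rfl | hk
  · norm_num
  have hk' : (7 : ℝ) ≤ k := by exact_mod_cast hk
  have h1 : (0 : ℝ) < (k - 1) ^ 2 := by nlinarith
  calc (1 + k / ((k : ℝ) - 1) ^ 2) ^ k ≤ (Real.exp (k / ((k : ℝ) - 1) ^ 2)) ^ k := by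
        gcongr
        rw [add_comm]; exact Real.add_one_le_exp _
    _ = Real.exp (k * (k / ((k : ℝ) - 1) ^ 2)) := by rw [← Real.exp_nat_mul]
    _ ≤ Real.exp (49 / 36) := by
        gcongr
        rw [← mul_div_assoc, div_le_div_iff₀ h1 (by norm_num)]
        nlinarith
    _ ≤ 4 := by
        have h2 : Real.exp (49 / 36) ^ 36 ≤ 4 ^ 36 := by
          rw [← Real.exp_nat_mul]
          have : ((36 : ℕ) : ℝ) * (49 / 36) = (49 : ℕ) * 1 := by norm_num
          rw [this, Real.exp_nat_mul]
          calc Real.exp 1 ^ 49 ≤ 2.7182818286 ^ 49 := by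
                gcongr; exact Real.exp_one_lt_d9.le
            _ ≤ _ := by norm_num
        exact le_of_pow_le_pow_left₀ (by norm_num) (by norm_num) h2

/-- The excluded cases really fail: the weight is $1/6$ for $n=4$ and $20/84$ for $n=9$. -/
lemma levelWeight_zero_ge_small {n k : ℕ} (hk : k = Nat.sqrt n) (hnk : 2 * k ≤ n) (h1 : 1 ≤ n)
    (h4 : n ≠ 4) (h9 : n ≠ 9) (hk5 : k ≤ 5) : 4⁻¹ ≤ levelWeight n k 0 := by
  have hlo : k * k ≤ n := hk ▸ Nat.sqrt_le n
  have hhi : n ≤ k * k + k + k := hk ▸ Nat.sqrt_le_add n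
  have hc : (0 : ℝ) < n.choose k := Nat.cast_pos.2 (Nat.choose_pos (by omega))
  rw [levelWeight_zero hnk, le_div_iff₀ hc, inv_mul_le_iff₀ (by norm_num)]
  have : n.choose k ≤ 4 * (n - k).choose k := by
    clear hk
    interval_cases k <;> interval_cases n <;> first | omega | simp_all [Nat.choose]
  exact_mod_cast this

lemma levelWeight_zero_ge {n k : ℕ} (hk : k = Nat.sqrt n) (hnk : 2 * k ≤ n) (h1 : 1 ≤ n)
    (h4 : n ≠ 4) (h9 : n ≠ 9) : 4⁻¹ ≤ levelWeight n k 0 := by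
  rcases Nat.lt_or_ge 5 k with hk5 | hk5
  swap
  · exact levelWeight_zero_ge_small hk hnk h1 h4 h9 hk5
  have hlo : ((k * k : ℕ) : ℝ) ≤ n := Nat.cast_le.2 (hk ▸ Nat.sqrt_le n)
  push_cast at hlo
  have hk' : (6 : ℝ) ≤ k := by exact_mod_cast hk5
  have hp : (0 : ℝ) < (k - 1) ^ 2 := by nlinarith
  -- Since $n\ge k^2$, one has $n-2k+1\ge(k-1)^2$, which dictates this `x`.
  have := levelWeight_zero_ge_of_pow_le hnk (x := k / ((k : ℝ) - 1) ^ 2) (B := 4) (by positivity)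
    (by rw [div_mul_eq_mul_div, le_div_iff₀ hp]; gcongr; nlinarith) (one_add_pow_le_four hk5)
  simpa using this

lemma levelWeight_succ_le {n k s : ℕ} (hk : k * k ≤ n) (hnk : 2 * k ≤ n) (hs2 : 2 ≤ s)
    (hs : s < k) : levelWeight n k (s + 1) ≤ levelWeight n k s * (1 / (s + 1)) := by
  rw [levelWeight_succ hnk hs]
  have hlo : (k * k : ℝ) ≤ n := by exact_mod_cast hk
  have h2 : (2 : ℝ) ≤ s := by exact_mod_cast hs2
  have h3 : (s : ℝ) + 1 ≤ k := by exact_mod_cast hs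
  have h5 : (0 : ℝ) < n - k - s := by nlinarith
  refine mul_le_mul_of_nonneg_left ?_ (levelWeight_nonneg n k s)
  rw [div_le_div_iff₀ (by positivity) (by positivity), one_mul, mul_comm]
  refine mul_le_mul_of_nonneg_left ?_ (by positivity)
  obtain ⟨d, hd, hnd⟩ : ∃ d : ℝ, 0 ≤ d ∧ (n : ℝ) = k * k + d := ⟨n - k * k, by linarith, by ring⟩
  rw [hnd]
  -- After cancelling, this is $2k\le sk$: the place where $s\ge2$ is needed.
  have h6 : ((k : ℝ) - s) * (k + 1) + d ≤ k * k + d - k - s := by nlinarith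
  have h7 : (((k : ℝ) - s) * (k + 1) + d) ^ 2 ≤ (k * k + d - k - s) ^ 2 := by
    apply pow_le_pow_left₀ _ h6
    have : 0 ≤ ((k : ℝ) - s) * (k + 1) := mul_nonneg (by linarith) (by linarith)
    linarith
  refine le_trans ?_ h7
  have h8 : 0 ≤ d * ((k : ℝ) - s) := mul_nonneg hd (by linarith)
  have h9 : 0 ≤ ((k : ℝ) - s) ^ 2 := sq_nonneg _
  nlinarith [mul_nonneg h8 (by linarith : (0 : ℝ) ≤ s), mul_nonneg h8 (by linarith : (0:ℝ) ≤ k),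
    mul_nonneg h9 (by linarith : (0 : ℝ) ≤ s), mul_nonneg h9 (by linarith : (0 : ℝ) ≤ k)]

/-- The weight $w_2$ is $w_0$ times two explicit ratios, and $w_0$ is bounded above through $\binom
nk/\binom{n-k}k\ge(1+k/(n-k))^k$. Bernoulli is applied to only $k-2$ of the factors, the other two
being kept exact. The constant is chosen so that $\frac{23}{16}\cdot\frac7{23}=\frac7{16}$. -/
lemma levelWeight_two_le {n k : ℕ} (hk : k * k ≤ n) (hnk : 2 * k ≤ n) (hk6 : 6 ≤ k) :
    levelWeight n k 2 ≤ 7 / 23 := by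
  have hlo : (k * k : ℝ) ≤ n := by exact_mod_cast hk
  have hk' : (6 : ℝ) ≤ k := by exact_mod_cast hk6
  have hp : (0 : ℝ) < n - k := by nlinarith
  have hp1 : (0 : ℝ) < n - k - 1 := by nlinarith
  have hc : (0 : ℝ) < n.choose k := Nat.cast_pos.2 (Nat.choose_pos (by omega))
  have hn0 : (0 : ℝ) < n := by nlinarith
  have hq : (0 : ℝ) < n + k ^ 2 - 3 * k := by nlinarith
  have h0 : levelWeight n k 0 ≤ (n - k) ^ 3 / (n ^ 2 * (n + k ^ 2 - 3 * k)) := by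
    have h1 := pow_mul_choose_le hnk (x := k / (n - k)) (by positivity)
      (by rw [div_mul_cancel₀ _ hp.ne'])
    have h2 : (n : ℝ) ^ 2 * (n + k ^ 2 - 3 * k) / (n - k) ^ 3 ≤ (1 + k / (n - k) : ℝ) ^ k := by
      have h3 := one_add_mul_le_pow (a := (k / (n - k) : ℝ)) (by
        have : (0 : ℝ) ≤ k / (n - k) := by positivity
        linarith) (k - 2)
      calc (n : ℝ) ^ 2 * (n + k ^ 2 - 3 * k) / (n - k) ^ 3
          = (1 + (k : ℝ) / (n - k)) ^ 2 * (1 + ((k - 2 : ℕ) : ℝ) * (k / (n - k))) := by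
            rw [Nat.cast_sub (by omega), one_add_div hp.ne', sub_add_cancel]
            push_cast
            field_simp
            ring
        _ ≤ (1 + (k : ℝ) / (n - k)) ^ 2 * (1 + (k : ℝ) / (n - k)) ^ (k - 2) := by gcongr
        _ = _ := by rw [← pow_add]; congr 1; omega
    rw [levelWeight_zero hnk, div_le_div_iff₀ hc (by positivity)]
    have h4 : (n : ℝ) ^ 2 * (n + k ^ 2 - 3 * k) / (n - k) ^ 3 * ((n - k).choose k : ℝ) ≤
        n.choose k := le_trans (by gcongr) h1
    rw [div_mul_eq_mul_div, div_le_iff₀ (by positivity)] at h4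
    linarith
  rw [show (2 : ℕ) = 0 + 1 + 1 from rfl, levelWeight_succ hnk (by omega),
    levelWeight_succ hnk (by omega)]
  push_cast
  simp only [sub_zero, zero_add, one_mul]
  calc levelWeight n k 0 * ((n : ℝ) * k ^ 2 / (n - k) ^ 2) *
        (((n : ℝ) - 1) * (k - 1) ^ 2 / ((1 + 1) * (n - k - 1) ^ 2))
      ≤ ((n : ℝ) - k) ^ 3 / (n ^ 2 * (n + k ^ 2 - 3 * k)) * (n * k ^ 2 / (n - k) ^ 2) *
        (n * (k - 1) ^ 2 / ((1 + 1) * (n - k - 1) ^ 2)) := by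
        have hn1 : (0 : ℝ) ≤ n - 1 := by nlinarith
        gcongr
        linarith
    _ = (k : ℝ) ^ 2 * (k - 1) ^ 2 * (n - k) / (2 * (n - k - 1) ^ 2 * (n + k ^ 2 - 3 * k)) := by
        field_simp
        norm_num
    _ ≤ 7 / 23 := by
        rw [div_le_div_iff₀ (by positivity) (by norm_num)]
        obtain ⟨d, hd, hnd⟩ : ∃ d : ℝ, 0 ≤ d ∧ (n : ℝ) = k * k + d :=
          ⟨n - k * k, by linarith, by ring⟩
        obtain ⟨e, he, hke⟩ : ∃ e : ℝ, 0 ≤ e ∧ (k : ℝ) = 6 + e := ⟨k - 6, by linarith, by ring⟩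
        -- In the nonnegative variables $d=n-k^2$ and $e=k-6$ the difference is a polynomial with
        -- nonnegative coefficients.
        rw [hnd, hke, ← sub_nonneg]
        ring_nf
        positivity

lemma sum_levelWeight_small {n k : ℕ} (hk : k = Nat.sqrt n) (hnk : 2 * k ≤ n) (h1 : 1 ≤ n)
    (h4 : n ≠ 4) (hk5 : k ≤ 5) : ∑ s ∈ Finset.Ioc 1 k, levelWeight n k s ≤ 7 / 16 := by
  have hlo : k * k ≤ n := hk ▸ Nat.sqrt_le n
  have hhi : n ≤ k * k + k + k := hk ▸ Nat.sqrt_le_add n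
  have hc : (0 : ℝ) < n.choose k := Nat.cast_pos.2 (Nat.choose_pos (by omega))
  have hc' : (0 : ℝ) < (n - k).choose k := Nat.cast_pos.2 (Nat.choose_pos (by omega))
  simp only [levelWeight, ← Finset.sum_div]
  rw [div_le_div_iff₀ (by positivity) (by norm_num)]
  have : (∑ s ∈ Finset.Ioc 1 k, n.choose s * ((n - k - s).choose (k - s)) ^ 2) * 16 ≤
      7 * (n.choose k * (n - k).choose k) := by
    clear hk hc hc'
    interval_cases k <;> interval_cases n <;> first | omega |
      simp_all [Finset.sum_Ioc_succ_top, Nat.choose]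
  exact_mod_cast this

lemma sum_levelWeight_one_le {n k : ℕ} (hk : k = Nat.sqrt n) (hnk : 2 * k ≤ n) (h1 : 1 ≤ n)
    (h4 : n ≠ 4) : ∑ s ∈ Finset.Ioc 1 k, levelWeight n k s ≤ 7 / 16 := by
  rcases Nat.lt_or_ge 5 k with hk5 | hk5
  swap
  · exact sum_levelWeight_small hk hnk h1 h4 hk5
  have hlo : k * k ≤ n := hk ▸ Nat.sqrt_le n
  have hstep := fun {s : ℕ} (h2 : 2 ≤ s) (hs : s < k) => levelWeight_succ_le hlo hnk h2 hs
  -- The constant is $1+\frac13+\frac1{12}+\frac1{48}=\frac{23}{16}$. From level $4$ on the ratios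
  -- are at most $1/5$, so a quarter of the last weight dominates everything after it.
  have key : ∀ m, 4 ≤ m → m ≤ k → ∑ s ∈ Finset.Ioc 1 m, levelWeight n k s +
      levelWeight n k m / 4 ≤ 23 / 16 * levelWeight n k 2 := by
    intro m hm
    induction m, hm using Nat.le_induction with
    | base =>
      intro _
      have h5 := hstep (s := 2) le_rfl (by omega)
      have h6 := hstep (s := 3) (by omega) (by omega)
      norm_num at h5 h6
      norm_num [Finset.sum_Ioc_succ_top]
      linarith
    | succ m hm ih =>
      intro hmk
      have h5 := ih (by omega)
      have h6 := hstep (s := m) (by omega) (by omega)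
      rw [Finset.sum_Ioc_succ_top (by omega)]
      have h7 : levelWeight n k m * (1 / (m + 1)) ≤ levelWeight n k m * (1 / (4 + 1)) := by
        have : (4 : ℝ) ≤ m := by exact_mod_cast hm
        have := levelWeight_nonneg n k m
        gcongr
      linarith
  have h5 := key k (by omega) le_rfl
  have h6 := levelWeight_two_le hlo hnk hk5
  have h7 := levelWeight_nonneg n k k
  linarith

/-- Beyond level $2$ each weight is at most half its predecessor, so the sum halves with each $r$.
The right side is $2a-a^2$ with $a=2^{-(r+1)}$, matching the target $2\varepsilon-\varepsilon^2$ for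
$\varepsilon>a$; at $r=1$ it is $7/16$. -/
lemma sum_levelWeight_le {n k : ℕ} (hk : k = Nat.sqrt n) (hnk : 2 * k ≤ n) (h1 : 1 ≤ n)
    (h4 : n ≠ 4) {r : ℕ} (hr : 1 ≤ r) :
    ∑ s ∈ Finset.Ioc r k, levelWeight n k s ≤ (1 / 2) ^ r - (1 / 4) ^ (r + 1) := by
  have hlo : k * k ≤ n := hk ▸ Nat.sqrt_le n
  induction r, hr using Nat.le_induction with
  | base => exact (sum_levelWeight_one_le hk hnk h1 h4).trans (by norm_num)
  | succ r hr ih =>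
    have h5 : ∑ s ∈ Finset.Ioc (r + 1) k, levelWeight n k s ≤
        (1 / 2) * ∑ s ∈ Finset.Ioc r k, levelWeight n k s := by
      rcases Nat.lt_or_ge k (r + 1) with h | h
      · rw [Finset.Ioc_eq_empty (by omega)]
        simp only [Finset.sum_empty]
        exact mul_nonneg (by norm_num) (Finset.sum_nonneg fun s _ => levelWeight_nonneg n k s)
      have h6 : ∑ s ∈ Finset.Ioc (r + 1) k, levelWeight n k s =
          ∑ s ∈ Finset.Ioc r (k - 1), levelWeight n k (s + 1) := by
        rw [show Finset.Ioc (r + 1) k = (Finset.Ioc r (k - 1)).map (addRightEmbedding 1) by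
          rw [Finset.map_add_right_Ioc, Nat.sub_add_cancel (by omega)], Finset.sum_map]
        rfl
      rw [h6, Finset.mul_sum]
      refine (Finset.sum_le_sum fun s hs => ?_).trans
        (Finset.sum_le_sum_of_subset_of_nonneg (Finset.Ioc_subset_Ioc_right (by omega))
          fun s _ _ => mul_nonneg (by norm_num) (levelWeight_nonneg n k s))
      rw [Finset.mem_Ioc] at hs
      refine (levelWeight_succ_le hlo hnk (by omega) (by omega)).trans ?_
      rw [mul_comm]
      have : (1 : ℝ) ≤ s := by exact_mod_cast (by omega : 1 ≤ s)
      have := levelWeight_nonneg n k s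
      gcongr
      linarith
    refine h5.trans ?_
    have h7 : (0 : ℝ) ≤ (1 / 4) ^ (r + 1) := by positivity
    rw [pow_succ (1 / 2 : ℝ) r, pow_succ (1 / 4 : ℝ) (r + 1)]
    linarith

/-! ### The tail for $k=\lfloor\sqrt n\rfloor$, with the exceptional $n=4$ and $n=9$. -/

section

variable {n k : ℕ} {V : OrthonormalBasis (Fin (n.choose k)) ℂ (SetReg n k)}
  {lam : Fin (n.choose k) → ℝ}

lemma one_sub_lt_sqrt {ε x : ℝ} (h : x < 2 * ε - ε ^ 2) :
    1 - ε < Real.sqrt (1 - x) :=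
  Real.lt_sqrt_of_sq_lt (by nlinarith)

lemma lt_pow_floor_of_logb {ε : ℝ} (h0 : 0 < ε) :
    (1 / 2 : ℝ) ^ (⌊Real.logb 2 (1 / ε)⌋₊ + 1) < ε := by
  have h1 := Nat.lt_floor_add_one (Real.logb 2 (1 / ε))
  have h3 : 1 / ε < (2 : ℝ) ^ (⌊Real.logb 2 (1 / ε)⌋₊ + 1) := by
    rw [← Real.rpow_natCast, ← Real.logb_lt_iff_lt_rpow (by norm_num) (by positivity)]
    exact_mod_cast h1
  rw [one_div_pow, one_div_lt (by positivity) h0]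
  exact h3

lemma logb_one_div_pos {ε : ℝ} (h0 : 0 < ε) (h1 : ε < 1) : 0 < Real.logb 2 (1 / ε) :=
  Real.logb_pos (by norm_num) ((one_lt_div h0).2 h1)

lemma pow_le_floor_rpow {n r : ℕ} (hn : 1 ≤ n) {y : ℝ} (hr : (r : ℝ) ≤ y) :
    n ^ r ≤ ⌊(n : ℝ) ^ y⌋₊ := by
  apply Nat.le_floor
  push_cast
  rw [← Real.rpow_natCast]
  exact Real.rpow_le_rpow_of_exponent_le (by exact_mod_cast hn) hr

/-- Here $t=\lfloor\varepsilon^{-2}\rfloor$, and concavity over the $6$ indices gives $\tau\le1-t/6$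
for $t\le6$. The four ranges of $\varepsilon$ guarantee $t\ge6,4,2,1$. -/
lemma tail_four_lt {k : ℕ} {V : OrthonormalBasis (Fin ((4 : ℕ).choose k)) ℂ (SetReg 4 k)}
    {lam : Fin ((4 : ℕ).choose k) → ℝ}
    (hV : IsOrderedEigenbasis V lam) (hR : IsRealBasis V) (hk : k = 2) {ε : ℝ} (h0 : 0 < ε)
    (h1 : ε < 1) {t : ℕ} (ht : t = ⌊((4 : ℕ) : ℝ) ^ Real.logb 2 (1 / ε)⌋₊) :
    tail lam t < 2 * ε - ε ^ 2 := by
  subst hk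
  have hpow : ((4 : ℕ) : ℝ) ^ Real.logb 2 (1 / ε) = (1 / ε) ^ 2 := by
    rw [show ((4 : ℕ) : ℝ) = (2 : ℝ) ^ (2 : ℝ) by norm_num, ← Real.rpow_mul (by norm_num), mul_comm,
      Real.rpow_mul (by norm_num), Real.rpow_logb (by norm_num) (by norm_num) (by positivity),
      Real.rpow_ofNat]
  rw [hpow] at ht
  have hch : (4 : ℕ).choose 2 = 6 := rfl
  have hge : ∀ m : ℕ, ε ^ 2 * m ≤ 1 → m ≤ t := fun m hm => by
    rw [ht]
    apply Nat.le_floor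
    rw [one_div_pow, le_div_iff₀ (by positivity), mul_comm]
    exact hm
  have hbound : ∀ m : ℕ, m ≤ t → m ≤ 6 → (m : ℝ) ≤ 6 * (1 - tail lam t) := by
    intro m hm hm6
    rcases Nat.lt_or_ge t 6 with h | h
    · have h3 := one_sub_tail_ge hV hR (by norm_num) (t := t) (m := 6) h.le (by rw [hch])
      rw [tail_eq_zero (by rw [hch])] at h3
      have : (m : ℝ) ≤ t := by exact_mod_cast hm
      push_cast at h3
      linarith
    · rw [tail_eq_zero (by rw [hch]; exact h)]
      have : (m : ℝ) ≤ 6 := by exact_mod_cast hm6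
      linarith
  have hsq : 0 < ε ^ 2 := by positivity
  rcases le_or_gt ε (1 / 4) with h | h
  · have := hbound 6 (hge 6 (by norm_num; nlinarith)) le_rfl
    push_cast at this; nlinarith
  rcases le_or_gt ε (1 / 2) with h | h
  · have := hbound 4 (hge 4 (by norm_num; nlinarith)) (by norm_num)
    push_cast at this; nlinarith
  rcases le_or_gt ε (3 / 5) with h | h
  · have := hbound 2 (hge 2 (by norm_num; nlinarith)) (by norm_num)
    push_cast at this; nlinarith
  · have := hbound 1 (hge 1 (by push_cast; nlinarith)) (by norm_num)
    push_cast at this; nlinarith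

/-- For $\varepsilon>3/5$ the top eigenvalue suffices. Otherwise $9\ge2^3$ gives
$t\ge\lfloor\varepsilon^{-3}\rfloor\ge4$, and concavity against the first $9$ eigenvalues, of share
at least $9/16$, gives $\tau\le3/4$. -/
lemma tail_nine_lt {k : ℕ} {V : OrthonormalBasis (Fin ((9 : ℕ).choose k)) ℂ (SetReg 9 k)}
    {lam : Fin ((9 : ℕ).choose k) → ℝ}
    (hV : IsOrderedEigenbasis V lam) (hR : IsRealBasis V) (hk : k = 3) {ε : ℝ} (h0 : 1 / 2 < ε)
    (h1 : ε < 1) {t : ℕ} (ht : t = ⌊((9 : ℕ) : ℝ) ^ Real.logb 2 (1 / ε)⌋₊) :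
    tail lam t < 2 * ε - ε ^ 2 := by
  have hε : 0 < ε := by linarith
  have hy := logb_one_div_pos hε h1
  have ht1 : 1 ≤ t := by
    rw [ht]
    simpa using pow_le_floor_rpow (n := 9) (r := 0) (by norm_num) (by simpa using hy.le)
  rcases le_or_gt ε (3 / 5) with h | h
  · have hpow : (1 / ε) ^ 3 ≤ ((9 : ℕ) : ℝ) ^ Real.logb 2 (1 / ε) := by
      calc (1 / ε) ^ 3 = ((2 : ℝ) ^ (3 : ℝ)) ^ Real.logb 2 (1 / ε) := by
            rw [← Real.rpow_mul (by norm_num), mul_comm, Real.rpow_mul (by norm_num),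
              Real.rpow_logb (by norm_num) (by norm_num) (by positivity), Real.rpow_ofNat]
        _ ≤ _ := Real.rpow_le_rpow (by positivity) (by norm_num) hy.le
    have ht4 : 4 ≤ t := by
      rw [ht]
      apply Nat.le_floor
      refine le_trans ?_ hpow
      rw [one_div_pow, le_div_iff₀ (by positivity)]
      have : ε ^ 3 ≤ (3 / 5) ^ 3 := by gcongr
      norm_num at this ⊢
      linarith
    have h9 := tail_le_sum_levelWeight (r := 1) (t := 9) (by omega) (by norm_num) hV (by norm_num)
    have h9' := h9.trans (sum_levelWeight_one_le (n := 9) (by norm_num [hk]) (by omega)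
      (by norm_num) (by norm_num))
    have hch : 9 ≤ (9 : ℕ).choose k := by subst hk; decide
    have hcalc : 4 * (1 - tail lam 9) ≤ 9 * (1 - tail lam t) := by
      rcases Nat.lt_or_ge t 9 with h' | h'
      · have h3 := one_sub_tail_ge hV hR (by omega) h'.le hch
        have : (4 : ℝ) ≤ t := by exact_mod_cast ht4
        push_cast at h3
        nlinarith
      · have h3 := tail_le_sum_levelWeight (r := 1) (t := t) (by omega) (by norm_num) hV
          (by omega)
        have h3' := h3.trans (sum_levelWeight_one_le (n := 9) (by norm_num [hk]) (by omega)
          (by norm_num) (by norm_num))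
        have := tail_nonneg (lam := lam) 9
        linarith
    nlinarith
  · have h2 := tail_le_one_sub hV hR (by omega) ht1
    have h3 : levelWeight 9 k 0 = 20 / 84 := by
      rw [levelWeight_zero (by omega), hk]
      norm_num [Nat.choose]
    rw [h3] at h2
    nlinarith

/-- With `⌊√n⌋`-subsets, the top `n ^ log₂ (1 / ε)` eigenvectors capture all but
`2 ε - ε²` of the squared norm. -/
lemma tail_lt_of_sqrt (hV : IsOrderedEigenbasis V lam) (hR : IsRealBasis V) (hn : 1 ≤ n)
    (hk : k = Nat.sqrt n) (hnk : 2 * k ≤ n) {ε : ℝ} (h0 : 0 < ε) (h1 : ε < 1) {t : ℕ}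
    (ht : t = ⌊(n : ℝ) ^ Real.logb 2 (1 / ε)⌋₊) : tail lam t < 2 * ε - ε ^ 2 := by
  by_cases h4 : n = 4
  · subst h4
    exact tail_four_lt hV hR (by norm_num [hk]) h0 h1 ht
  have hy := logb_one_div_pos h0 h1
  have hε := lt_pow_floor_of_logb h0
  have htr : n ^ ⌊Real.logb 2 (1 / ε)⌋₊ ≤ t := ht ▸ pow_le_floor_rpow hn (Nat.floor_le hy.le)
  generalize ⌊Real.logb 2 (1 / ε)⌋₊ = r at hε htr
  rcases Nat.eq_zero_or_pos r with rfl | hr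
  · by_cases h9 : n = 9
    · subst h9
      exact tail_nine_lt hV hR (by norm_num [hk]) (by simpa using hε) h1 ht
    have h2 := tail_le_one_sub hV hR hnk (by simpa using htr)
    have h3 := levelWeight_zero_ge hk hnk hn h4 h9
    norm_num at hε h3
    nlinarith
  · refine (tail_le_sum_levelWeight hnk hn hV htr).trans_lt
      ((sum_levelWeight_le hk hnk hn h4 hr).trans_lt ?_)
    have h5 : (1 / 4 : ℝ) ^ (r + 1) = ((1 / 2) ^ (r + 1)) ^ 2 := by
      rw [← pow_mul, mul_comm, pow_mul]; norm_num
    have h6 : (1 / 2 : ℝ) ^ r = 2 * (1 / 2) ^ (r + 1) := by rw [pow_succ]; ring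
    rw [h5, h6]
    nlinarith

end

/-! ### Subsets of size `O(√n)` -/

lemma levelWeight_le_div_factorial {n k : ℕ} (hnk : 2 * k ≤ n) {c : ℝ}
    (hk : (k : ℝ) ^ 2 ≤ c ^ 2 * n) {s : ℕ} (hs : s ≤ k) :
    levelWeight n k s ≤ (4 * c ^ 2) ^ s / s.factorial := by
  induction s with
  | zero =>
    have hc : (0 : ℝ) < n.choose k := Nat.cast_pos.2 (Nat.choose_pos (by omega))
    rw [levelWeight_zero hnk, pow_zero, Nat.factorial_zero, Nat.cast_one, div_one,
      div_le_one hc]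
    exact_mod_cast Nat.choose_le_choose k (Nat.sub_le n k)
  | succ s ih =>
    rw [levelWeight_succ hnk (by omega), pow_succ, Nat.factorial_succ]
    have h1 : (s : ℝ) + 1 ≤ k := by exact_mod_cast hs
    have h2 : (2 * k : ℝ) ≤ n := by exact_mod_cast hnk
    have h0 : (0 : ℝ) ≤ s := by positivity
    have hp : (0 : ℝ) < n - k - s := by linarith
    have h3 : ((n : ℝ) - s) * (k - s) ^ 2 / ((s + 1) * (n - k - s) ^ 2) ≤ 4 * c ^ 2 / (s + 1) := by
      rw [div_le_div_iff₀ (by positivity) (by positivity)]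
      have h4 : ((n : ℝ) - s) * (k - s) ^ 2 ≤ 4 * c ^ 2 * (n - k - s) ^ 2 := by
        -- The difference of the two sides is $(k+s)(n-2k)$.
        have h5 : (k - s : ℝ) * n ≤ 2 * k * (n - k - s) := by nlinarith
        have h6 : ((k - s : ℝ) * n) ^ 2 ≤ (2 * k * (n - k - s)) ^ 2 :=
          pow_le_pow_left₀ (mul_nonneg (by linarith) (by positivity)) h5 2
        have hn : (0 : ℝ) < n := by linarith
        have h7 : n * (((n : ℝ) - s) * (k - s) ^ 2) ≤ n * (4 * c ^ 2 * (n - k - s) ^ 2) := by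
          nlinarith [mul_nonneg (mul_nonneg hn.le h0) (sq_nonneg ((k : ℝ) - s)),
            mul_le_mul_of_nonneg_right hk (sq_nonneg ((n : ℝ) - k - s))]
        exact le_of_mul_le_mul_left h7 hn
      nlinarith
    calc levelWeight n k s * (((n : ℝ) - s) * (k - s) ^ 2 / ((s + 1) * (n - k - s) ^ 2))
        ≤ (4 * c ^ 2) ^ s / s.factorial * (4 * c ^ 2 / (s + 1)) := by
          refine mul_le_mul (ih (by omega)) h3 ?_ (by positivity)
          have : (0 : ℝ) ≤ n - s := by linarith
          positivity
      _ = _ := by push_cast; field_simp; ring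

lemma sum_levelWeight_le_exp {n k : ℕ} (hnk : 2 * k ≤ n) {c : ℝ}
    (hk : (k : ℝ) ^ 2 ≤ c ^ 2 * n) (r : ℕ) :
    ∑ s ∈ Finset.Ioc r k, levelWeight n k s ≤ (1 / 2) ^ r * Real.exp (8 * c ^ 2) := by
  calc ∑ s ∈ Finset.Ioc r k, levelWeight n k s
      ≤ ∑ s ∈ Finset.Ioc r k, (1 / 2) ^ r * ((8 * c ^ 2) ^ s / s.factorial) := by
        refine Finset.sum_le_sum fun s hs => ?_
        rw [Finset.mem_Ioc] at hs
        refine (levelWeight_le_div_factorial hnk hk hs.2).trans ?_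
        -- Splitting off $2^{-s}\le2^{-r}$ leaves a partial sum of $\exp(8c^2)$.
        have h1 : (4 * c ^ 2) ^ s = (1 / 2) ^ s * (8 * c ^ 2) ^ s := by
          rw [← mul_pow]; ring
        rw [h1, mul_div_assoc]
        refine mul_le_mul_of_nonneg_right ?_ (by positivity)
        exact pow_le_pow_of_le_one (by norm_num) (by norm_num) hs.1.le
    _ ≤ ∑ s ∈ Finset.range (k + 1), (1 / 2) ^ r * ((8 * c ^ 2) ^ s / s.factorial) := by
        refine Finset.sum_le_sum_of_subset_of_nonneg ?_ fun s _ _ => by positivity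
        intro s hs
        rw [Finset.mem_Ioc] at hs
        exact Finset.mem_range.2 (by omega)
    _ ≤ _ := by
        rw [← Finset.mul_sum]
        exact mul_le_mul_of_nonneg_left (Real.sum_le_exp_of_nonneg (by positivity) _)
          (by positivity)

/-- If $4k\le n$, the binomial ratio is at most $(1+2k/n)^k\le e^{2c^2}$. Otherwise $n<4k$ and
$k^2\le c^2n$ force $n\le16c^2$, and $\binom nk\le2^n$ is enough. -/
lemma exists_levelWeight_zero_ge {c : ℝ} (hc : 0 < c) : ∃ δ : ℝ, 0 < δ ∧ δ < 1 ∧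
    ∀ n k : ℕ, 2 * k ≤ n → (k : ℝ) ^ 2 ≤ c ^ 2 * n → δ ≤ levelWeight n k 0 := by
  refine ⟨min (1 / Real.exp (2 * c ^ 2)) (1 / 2 ^ (16 * c ^ 2)), by positivity, ?_, ?_⟩
  · refine (min_le_left _ _).trans_lt ?_
    rw [div_lt_one (by positivity)]
    exact Real.one_lt_exp_iff.2 (by positivity)
  intro n k hnk hk
  rcases Nat.eq_zero_or_pos n with rfl | hn
  · obtain rfl : k = 0 := by omega
    refine (min_le_left _ _).trans ?_
    rw [levelWeight_zero (by simp), div_le_iff₀ (by positivity)]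
    simpa using Real.one_le_exp (by positivity : 0 ≤ 2 * c ^ 2)
  have hn' : (0 : ℝ) < n := by exact_mod_cast hn
  have hnk' : (2 * k : ℝ) ≤ n := by exact_mod_cast hnk
  rcases le_or_gt (4 * k) n with h | h
  · refine (min_le_left _ _).trans ?_
    have h4 : (4 * k : ℝ) ≤ n := by exact_mod_cast h
    refine levelWeight_zero_ge_of_pow_le hnk (x := 2 * k / n) (by positivity) ?_ ?_
    · rw [div_mul_eq_mul_div, le_div_iff₀ hn']
      nlinarith
    · calc (1 + 2 * k / n : ℝ) ^ k ≤ (Real.exp (2 * k / n)) ^ k := by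
            gcongr
            rw [add_comm]; exact Real.add_one_le_exp _
        _ = Real.exp (2 * k ^ 2 / n) := by rw [← Real.exp_nat_mul]; ring_nf
        _ ≤ _ := by
            gcongr
            rw [div_le_iff₀ hn']
            linarith
  · refine (min_le_right _ _).trans ?_
    have h4 : (n : ℝ) < 4 * k := by exact_mod_cast h
    have hc1 : (0 : ℝ) < n.choose k := Nat.cast_pos.2 (Nat.choose_pos (by omega))
    have hc2 : (1 : ℝ) ≤ (n - k).choose k := by exact_mod_cast Nat.choose_pos (by omega)
    have hnc : (n : ℝ) ≤ 16 * c ^ 2 := by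
      by_contra! hlt
      nlinarith
    have h5 : (n.choose k : ℝ) ≤ 2 ^ (16 * c ^ 2) := by
      calc (n.choose k : ℝ) ≤ (2 : ℝ) ^ n := by exact_mod_cast Nat.choose_le_two_pow n k
        _ = (2 : ℝ) ^ (n : ℝ) := (Real.rpow_natCast _ _).symm
        _ ≤ _ := Real.rpow_le_rpow_of_exponent_le (by norm_num) hnc
    rw [levelWeight_zero hnk]
    exact div_le_div₀ (by positivity) hc2 hc1 h5

/-- A bound `2 ^ (-θ (r + 2))` on the tail after the first `n ^ r` eigenvectors, uniform in
`n`, `k` and `r`. -/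
lemma exists_tail_lt {c : ℝ} (hc : 0 < c) : ∃ θ : ℝ, 0 < θ ∧
    ∀ n k : ℕ, 1 ≤ n → 2 * k ≤ n → (k : ℝ) ≤ c * Real.sqrt n →
      ∀ (V : OrthonormalBasis (Fin (n.choose k)) ℂ (SetReg n k)) (lam : Fin (n.choose k) → ℝ),
        IsOrderedEigenbasis V lam → IsRealBasis V → ∀ r t : ℕ, n ^ r ≤ t →
          tail lam t < (2 : ℝ) ^ (-(θ * (r + 2))) := by
  obtain ⟨δ, hδ, hδ1, hP⟩ := exists_levelWeight_zero_ge hc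
  obtain ⟨R, hR⟩ := exists_nat_gt (2 + 16 * c ^ 2 * Real.logb 2 (Real.exp 1))
  have hb : 0 ≤ 16 * c ^ 2 * Real.logb 2 (Real.exp 1) :=
    mul_nonneg (by positivity) (Real.logb_nonneg (by norm_num) (Real.one_le_exp (by norm_num)))
  have hR0 : (0 : ℝ) < R := by linarith
  -- For $r\le R$ the top eigenvalue gives $\tau\le1-\delta<2^{-\delta}$, which needs
  -- $\theta(R+2)\le\delta$. For $r>R$ the geometric bound $2^{-r}e^{8c^2}$ is below $2^{-(r+2)/2}$,
  -- by the choice of `R`.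
  refine ⟨min (1 / 2) (δ / (R + 2)), by positivity, ?_⟩
  intro n k hn hnk hk V lam hV hreal r t ht
  have hk2 : (k : ℝ) ^ 2 ≤ c ^ 2 * n := by
    calc (k : ℝ) ^ 2 ≤ (c * Real.sqrt n) ^ 2 := by gcongr
      _ = _ := by rw [mul_pow, Real.sq_sqrt (by positivity)]
  have ht1 : 1 ≤ t := (Nat.one_le_pow _ _ hn).trans ht
  rcases le_or_gt r R with h | h
  · have h1 := tail_le_one_sub hV hreal hnk ht1
    have h2 := hP n k hnk hk2
    have hrR : (r : ℝ) ≤ R := by exact_mod_cast h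
    have h3 : min (1 / 2) (δ / (R + 2)) * (r + 2) ≤ δ := by
      calc min (1 / 2) (δ / (R + 2)) * (r + 2) ≤ δ / (R + 2) * (R + 2) := by
            gcongr
            exact min_le_right _ _
        _ = δ := div_mul_cancel₀ _ (by positivity)
    have h4 : 1 - δ < (2 : ℝ) ^ (-δ) := by
      rw [Real.rpow_def_of_pos (by norm_num)]
      have h5 := Real.add_one_le_exp (Real.log 2 * -δ)
      have h6 := Real.log_two_lt_d9
      nlinarith
    have h5 : (2 : ℝ) ^ (-δ) ≤ 2 ^ (-(min (1 / 2) (δ / (R + 2)) * (r + 2))) :=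
      Real.rpow_le_rpow_of_exponent_le (by norm_num) (by linarith)
    linarith
  · have hrR : (R : ℝ) < r := by exact_mod_cast h
    refine ((tail_le_sum_levelWeight hnk hn hV ht).trans
      (sum_levelWeight_le_exp hnk hk2 r)).trans_lt ?_
    have h1 : Real.exp (8 * c ^ 2) = (2 : ℝ) ^ (8 * c ^ 2 * Real.logb 2 (Real.exp 1)) := by
      rw [mul_comm (8 * c ^ 2) (Real.logb _ _), Real.rpow_mul (by norm_num),
        Real.rpow_logb (by norm_num) (by norm_num) (Real.exp_pos _), ← Real.exp_mul, one_mul]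
    have h2 : (1 / 2 : ℝ) ^ r = (2 : ℝ) ^ (-(r : ℝ)) := by
      rw [Real.rpow_neg (by norm_num), Real.rpow_natCast, one_div, inv_pow]
    rw [h1, h2, ← Real.rpow_add (by norm_num)]
    refine Real.rpow_lt_rpow_of_exponent_lt (by norm_num) ?_
    have h3 : min (1 / 2) (δ / (R + 2)) * (r + 2) ≤ 1 / 2 * (r + 2) := by
      gcongr
      exact min_le_left _ _
    linarith

/-! ### The protocol from shared qubits. -/

lemma ket_eq_basisFun {ι : Type*} [Fintype ι] [DecidableEq ι] (i : ι) :
    (ket i : EuclideanSpace ℂ ι) = (EuclideanSpace.basisFun ι ℂ).toBasis i := by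
  simp [ket]

lemma orthonormal_ket {ι : Type*} [Fintype ι] [DecidableEq ι] :
    Orthonormal ℂ (ket : ι → EuclideanSpace ℂ ι) := by
  rw [funext ket_eq_basisFun, OrthonormalBasis.coe_toBasis]
  exact (EuclideanSpace.basisFun ι ℂ).orthonormal

lemma padString_injective {a L : ℕ} (h : a ≤ L) :
    Function.Injective (padString (a := a) L) := by
  intro x y hxy
  ext1 i
  simpa [padString] using congrFun hxy ⟨i, i.2.trans_le h⟩

lemma addAncilla_ket (a L : ℕ) (x : Fin a → Bool) :
    addAncilla a L (ket x) = ket (padString L x) := by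
  rw [ket_eq_basisFun x]
  exact (EuclideanSpace.basisFun (Fin a → Bool) ℂ).toBasis.constr_basis ℂ
    (fun x => ket (padString L x)) x

lemma encode_ket (n k L : ℕ) (S : KSet n k) :
    encode n k L (ket S) = ket (padString L fun i => decide (i ∈ S.1)) := by
  rw [ket_eq_basisFun S]
  exact (EuclideanSpace.basisFun (KSet n k) ℂ).toBasis.constr_basis ℂ
    (fun S => ket (padString L fun i => decide (i ∈ S.1))) S

lemma exists_isometry_eq_addAncilla {a L : ℕ} (h : a ≤ L) :
    ∃ f : Qubits a →ₗᵢ[ℂ] Qubits L, f.toLinearMap = addAncilla a L := by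
  refine ⟨(addAncilla a L).isometryOfOrthonormal
    (v := (EuclideanSpace.basisFun (Fin a → Bool) ℂ).toBasis) ?_ ?_, rfl⟩
  · rw [← funext ket_eq_basisFun]
    exact orthonormal_ket
  · convert orthonormal_ket.comp _ (padString_injective h) using 1
    ext1 x
    rw [Function.comp_apply, Function.comp_apply, ← ket_eq_basisFun, addAncilla_ket]

lemma exists_isometry_eq_encode {n k L : ℕ} (h : n ≤ L) :
    ∃ f : SetReg n k →ₗᵢ[ℂ] Qubits L, f.toLinearMap = encode n k L := by
  have hinj : Function.Injective fun S : KSet n k => padString L fun i => decide (i ∈ S.1) := by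
    intro S T hST
    have := padString_injective h hST
    ext i
    simpa using congrFun this i
  refine ⟨(encode n k L).isometryOfOrthonormal
    (v := (EuclideanSpace.basisFun (KSet n k) ℂ).toBasis) ?_ ?_, rfl⟩
  · rw [← funext ket_eq_basisFun]
    exact orthonormal_ket
  · convert orthonormal_ket.comp _ hinj using 1
    ext1 x
    rw [Function.comp_apply, Function.comp_apply, ← ket_eq_basisFun, encode_ket]

/-- An injective partial assignment of orthonormal vectors to computational basis states extends
to a unitary. -/
lemma exists_unitary_ket {ι κ : Type*} [Fintype κ] [DecidableEq κ] (p : ι → κ)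
    (hp : Function.Injective p) (w : ι → EuclideanSpace ℂ κ) (hw : Orthonormal ℂ w) :
    ∃ U : EuclideanSpace ℂ κ ≃ₗᵢ[ℂ] EuclideanSpace ℂ κ, ∀ i, U (ket (p i)) = w i := by
  classical
  have horth : Orthonormal ℂ ((Set.range p).domRestrict (Function.extend p w 0)) := by
    rw [orthonormal_iff_ite]
    rintro ⟨_, i, rfl⟩ ⟨_, j, rfl⟩
    have hij : (⟨p i, Set.mem_range_self i⟩ : Set.range p) = ⟨p j, Set.mem_range_self j⟩ ↔
        i = j := Subtype.ext_iff.trans hp.eq_iff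
    simp only [Set.domRestrict_apply, hp.extend_apply, orthonormal_iff_ite.1 hw, hij]
  obtain ⟨b, hb⟩ := horth.exists_orthonormalBasis_extension_of_card_eq (by simp)
  refine ⟨(EuclideanSpace.basisFun κ ℂ).equiv b (Equiv.refl _), fun i => ?_⟩
  have h := hb (p i) ⟨i, rfl⟩
  rw [hp.extend_apply] at h
  rw [← h]
  simpa [ket] using (EuclideanSpace.basisFun κ ℂ).equiv_apply_basis b (Equiv.refl _) (p i)

/-- The shared state is the normalized truncation with $v_j$ replaced by an $m$-bit label of
$j<2^m$. Both parties apply the same unitary, which sends padded labels to encoded eigenvectors. -/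
lemma qSamples_of_tail {n k : ℕ} {V : OrthonormalBasis (Fin (n.choose k)) ℂ (SetReg n k)}
    {lam : Fin (n.choose k) → ℝ} (hV : IsOrderedEigenbasis V lam) (hR : IsRealBasis V)
    (hnk : 2 * k ≤ n) {m : ℕ} {ε : ℝ} (hε : ε < 1) (h : tail lam (2 ^ m) < 2 * ε - ε ^ 2) :
    QSamples n k ε m m := by
  obtain ⟨fe, hfe⟩ := exists_isometry_eq_encode (n := n) (k := k) (le_max_left n m)
  obtain ⟨fa, hfa⟩ := exists_isometry_eq_addAncilla (le_max_right n m)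
  let L := max n m
  let w : Fin (n.choose k) → Qubits L := fun j => fe (V j)
  have hw : Orthonormal ℂ w := V.orthonormal.comp_linearIsometry fe
  let g : Fin (2 ^ m) ≃ (Fin m → Bool) := (Fintype.equivFinOfCardEq (by simp)).symm
  -- The default string for $j\ge2^m$ is harmless, since those coefficients vanish.
  let str : Fin (n.choose k) → (Fin m → Bool) := fun j =>
    if hj : (j : ℕ) < 2 ^ m then g ⟨j, hj⟩ else fun _ => false
  let p : {j : Fin (n.choose k) // (j : ℕ) < 2 ^ m} → (Fin L → Bool) := fun j =>
    padString L (str j)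
  have hp : Function.Injective p := by
    intro i j hij
    have h1 := padString_injective (le_max_right n m) hij
    simp only [str, i.2, j.2, dif_pos, EmbeddingLike.apply_eq_iff_eq, Fin.mk.injEq] at h1
    exact Subtype.ext (Fin.ext h1)
  obtain ⟨U, hU⟩ := exists_unitary_ket p hp (fun j => w j) (hw.comp _ Subtype.val_injective)
  let s : ℝ := Real.sqrt (1 - tail lam (2 ^ m))
  have hs : 1 - ε < s := one_sub_lt_sqrt h
  have hs0 : 0 < s := by linarith
  have hs2 : s ^ 2 = 1 - tail lam (2 ^ m) := Real.sq_sqrt (by nlinarith)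
  let coeff : Fin (n.choose k) → ℝ := fun j => s⁻¹ * headCoeff lam (2 ^ m) j
  let φ : Qubits m ⊗[ℂ] Qubits m := diagTensor (fun j => ket (str j)) coeff
  have himage : TensorProduct.congrIsometry U U
      (TensorProduct.map (addAncilla m L) (addAncilla m L) φ) = diagTensor w coeff := by
    rw [map_diagTensor _ _ _ (fun j => ket (padString L (str j))) _
      (fun j _ => addAncilla_ket m L _) (fun j _ => addAncilla_ket m L _)]
    have hUj : ∀ j, coeff j ≠ 0 → U (ket (padString L (str j))) = w j := by
      intro j hj
      have hjt : (j : ℕ) < 2 ^ m := by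
        by_contra hjt
        exact hj (by simp [coeff, headCoeff, hjt])
      exact hU ⟨j, hjt⟩
    exact map_diagTensor U.toLinearEquiv.toLinearMap U.toLinearEquiv.toLinearMap _ w _ hUj hUj
  refine ⟨L, L, le_max_right _ _, le_max_right _ _, le_max_left _ _, le_max_left _ _, φ, U, U,
    ?_, ?_⟩
  · rw [← TensorProduct.norm_map fa fa, hfa, ← LinearIsometryEquiv.norm_map
      (TensorProduct.congrIsometry U U)]
    change ‖TensorProduct.congrIsometry U U
      (TensorProduct.map (addAncilla m L) (addAncilla m L) φ)‖ = 1
    rw [himage, ← sq_eq_sq₀ (norm_nonneg _) zero_le_one, norm_sq_diagTensor hw]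
    simp only [coeff, mul_pow]
    rw [← Finset.mul_sum, sum_sq_headCoeff hV hR hnk, ← hs2, inv_pow, one_pow,
      inv_mul_cancel₀ (by positivity)]
  · rw [himage, chi_eq_diagTensor hV hR, map_diagTensor _ _ _ w _ (fun j _ => by rw [← hfe]; rfl)
      (fun j _ => by rw [← hfe]; rfl), inner_diagTensor hw, Complex.ofReal_re]
    have h2 : ∑ j, lam j / Real.sqrt (numDisjoint n k) * coeff j =
        s⁻¹ * ∑ j, headCoeff lam (2 ^ m) j ^ 2 := by
      rw [Finset.mul_sum]
      refine Finset.sum_congr rfl fun j _ => ?_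
      simp only [coeff, headCoeff]
      split_ifs <;> ring
    rw [h2, sum_sq_headCoeff hV hR hnk, ← hs2, sq, inv_mul_cancel_left₀ hs0.ne']
    exact hs

/-- Lowering the exponent by one pays for the floor on the number of qubits, since $\log_2 n\ge1$
for $n\ge2$. This loss is why the tail bound is stated with $r+2$. -/
lemma pow_le_two_pow_floor {n r : ℕ} (hn : 1 ≤ n) {y : ℝ} (hy : 0 ≤ y) (hr : r = ⌊y⌋₊ - 1) :
    n ^ r ≤ 2 ^ ⌊y * Real.logb 2 n⌋₊ := by
  rcases hn.eq_or_lt with rfl | hn2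
  · simp
  rcases Nat.eq_zero_or_pos r with rfl | hr0
  · simpa using Nat.one_le_two_pow
  have hn' : (0 : ℝ) < n := by positivity
  have hlog : 1 ≤ Real.logb 2 n := by
    rw [Real.le_logb_iff_rpow_le (by norm_num) hn', Real.rpow_one]
    exact_mod_cast hn2
  have h1 : (r : ℝ) + 1 ≤ y := by
    refine le_trans ?_ (Nat.floor_le hy)
    exact_mod_cast (by omega : r + 1 ≤ ⌊y⌋₊)
  have h2 := Nat.lt_floor_add_one (y * Real.logb 2 n)
  have h3 : Real.logb 2 n * r ≤ (⌊y * Real.logb 2 n⌋₊ : ℝ) := by nlinarith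
  have h4 : (n : ℝ) ^ r ≤ 2 ^ ⌊y * Real.logb 2 n⌋₊ := by
    rw [← Real.rpow_natCast 2, ← Real.rpow_natCast]
    calc (n : ℝ) ^ (r : ℝ) = (2 : ℝ) ^ (Real.logb 2 n * r) := by
          rw [Real.rpow_mul (by norm_num), Real.rpow_logb (by norm_num) (by norm_num) hn']
      _ ≤ _ := Real.rpow_le_rpow_of_exponent_le (by norm_num) h3
  exact_mod_cast h4

lemma rpow_neg_le_of_logb_le {ε x : ℝ} (h0 : 0 < ε) (h : Real.logb 2 (1 / ε) ≤ x) :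
    (2 : ℝ) ^ (-x) ≤ ε := by
  rw [Real.rpow_neg (by norm_num), inv_le_comm₀ (by positivity) h0, ← one_div,
    ← Real.logb_le_iff_le_rpow (by norm_num) (by positivity)]
  exact h

end DisjSampling

theorem theorem1 :
    -- subsets of size `⌊√n⌋`, top `⌊n ^ log₂ (1 / ε)⌋` eigenvectors
    (∀ n k : ℕ, 1 ≤ n → k = Nat.sqrt n → 2 * k ≤ n →
      ∃ (V : OrthonormalBasis (Fin (n.choose k)) ℂ (DisjSampling.SetReg n k))
        (lam : Fin (n.choose k) → ℝ),
        DisjSampling.IsOrderedEigenbasis V lam ∧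
        ∀ ε : ℝ, 0 < ε → ε < 1 → ∀ t : ℕ, t = ⌊(n : ℝ) ^ Real.logb 2 (1 / ε)⌋₊ →
          1 - ε < (inner ℂ (DisjSampling.chi n k)
            (DisjSampling.rotate V (DisjSampling.pureState (DisjSampling.psi V t)))).re ∧
          ‖DisjSampling.chi n k - DisjSampling.rotate V (DisjSampling.psi V t)‖ ^ 2 =
            DisjSampling.tail lam t ∧
          DisjSampling.tail lam t < 2 * ε) ∧
    -- subsets of size `k = O(√n)`, top `n ^ O(log (1 / ε))` eigenvectors, and the protocol
    (∀ c : ℝ, 0 < c → ∃ C : ℝ, 0 < C ∧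
      ∀ n k : ℕ, 1 ≤ n → (k : ℝ) ≤ c * Real.sqrt n → 2 * k ≤ n →
        (∃ (V : OrthonormalBasis (Fin (n.choose k)) ℂ (DisjSampling.SetReg n k))
          (lam : Fin (n.choose k) → ℝ),
          DisjSampling.IsOrderedEigenbasis V lam ∧
          ∀ ε : ℝ, 0 < ε → ε < 1 → ∀ t : ℕ, t = ⌊(n : ℝ) ^ (C * Real.logb 2 (1 / ε))⌋₊ →
            1 - ε < (inner ℂ (DisjSampling.chi n k)
              (DisjSampling.rotate V (DisjSampling.psi V t))).re ∧
            1 - ε < (inner ℂ (DisjSampling.chi n k)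
              (DisjSampling.rotate V (DisjSampling.pureState (DisjSampling.psi V t)))).re ∧
            ‖DisjSampling.chi n k - DisjSampling.rotate V (DisjSampling.psi V t)‖ ^ 2 =
              DisjSampling.tail lam t ∧
            DisjSampling.tail lam t < 2 * ε) ∧
        ∀ ε : ℝ, 0 < ε → ε < 1 → ∃ a b : ℕ,
          (a + b : ℝ) ≤ C * Real.logb 2 n * Real.logb 2 (1 / ε) ∧
          DisjSampling.QSamples n k ε a b) := by
  refine ⟨fun n k hn hk hnk => ?_, fun c hc => ?_⟩
  · obtain ⟨V, lam, hV, hR⟩ := DisjSampling.exists_real_orderedEigenbasis n k (by omega)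
    refine ⟨V, lam, hV, fun ε h0 h1 t ht => ?_⟩
    have h := DisjSampling.tail_lt_of_sqrt hV hR hn hk hnk h0 h1 ht
    refine ⟨?_, DisjSampling.norm_chi_sub hV hR t, by nlinarith⟩
    rw [DisjSampling.inner_chi_pureState hV hR hnk]
    exact DisjSampling.one_sub_lt_sqrt h
  · obtain ⟨θ, hθ, htail⟩ := DisjSampling.exists_tail_lt hc
    -- Each party holds at most $\theta^{-1}\log_2 n\log_2(1/\varepsilon)$ qubits; the factor $2$
    -- counts both registers.
    refine ⟨2 / θ, by positivity, fun n k hn hk hnk => ?_⟩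
    obtain ⟨V, lam, hV, hR⟩ := DisjSampling.exists_real_orderedEigenbasis n k (by omega)
    have hlt : ∀ ε : ℝ, 0 < ε → ε < 1 → ∀ r t : ℕ,
        Real.logb 2 (1 / ε) ≤ θ * (r + 2) → n ^ r ≤ t → DisjSampling.tail lam t < ε :=
      fun ε h0 h1 r t hr ht => (htail n k hn hnk hk V lam hV hR r t ht).trans_le
        (DisjSampling.rpow_neg_le_of_logb_le h0 hr)
    refine ⟨⟨V, lam, hV, fun ε h0 h1 t ht => ?_⟩, fun ε h0 h1 => ?_⟩
    · have hy := DisjSampling.logb_one_div_pos h0 h1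
      -- A tail below $\varepsilon$ serves both overlaps, because
      -- $\varepsilon<2\varepsilon-\varepsilon^2$ on $(0,1)$.
      have h : DisjSampling.tail lam t < ε := by
        refine hlt ε h0 h1 ⌊2 / θ * Real.logb 2 (1 / ε)⌋₊ t ?_
          (ht ▸ DisjSampling.pow_le_floor_rpow hn (Nat.floor_le (by positivity)))
        have h2 := (Nat.lt_floor_add_one (2 / θ * Real.logb 2 (1 / ε))).le
        rw [div_mul_eq_mul_div, div_le_iff₀ hθ] at h2
        rw [div_mul_eq_mul_div]
        nlinarith
      refine ⟨?_, ?_, DisjSampling.norm_chi_sub hV hR t, by linarith⟩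
      · rw [DisjSampling.inner_chi_psi hV hR hnk]
        linarith
      · rw [DisjSampling.inner_chi_pureState hV hR hnk]
        exact DisjSampling.one_sub_lt_sqrt (by nlinarith)
    · have hy := DisjSampling.logb_one_div_pos h0 h1
      have hn' : (1 : ℝ) ≤ n := by exact_mod_cast hn
      have hlog : 0 ≤ Real.logb 2 n := Real.logb_nonneg (by norm_num) hn'
      set y := Real.logb 2 (1 / ε) / θ with hydef
      have hy0 : 0 < y := by positivity
      refine ⟨⌊y * Real.logb 2 n⌋₊, ⌊y * Real.logb 2 n⌋₊, ?_, ?_⟩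
      · have h2 := Nat.floor_le (mul_nonneg hy0.le hlog)
        have h3 : 2 / θ * Real.logb 2 n * Real.logb 2 (1 / ε) = 2 * (y * Real.logb 2 n) := by
          rw [hydef]; ring
        linarith
      · refine DisjSampling.qSamples_of_tail hV hR hnk h1 ?_
        have h := hlt ε h0 h1 (⌊y⌋₊ - 1) (2 ^ ⌊y * Real.logb 2 n⌋₊) ?_
          (DisjSampling.pow_le_two_pow_floor hn hy0.le rfl)
        · nlinarith
        · have h4 := Nat.lt_floor_add_one y
          have h5 : (⌊y⌋₊ : ℝ) ≤ ((⌊y⌋₊ - 1 : ℕ) : ℝ) + 1 := by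
            exact_mod_cast (by omega : ⌊y⌋₊ ≤ ⌊y⌋₊ - 1 + 1)
          have h6 : Real.logb 2 (1 / ε) = θ * y := by rw [hydef]; field_simp
          rw [h6]
          gcongr
          linarith
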